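/- Let $L/k$ be a cyclic Galois extension of number fields of degree $n$ with $\mathrm{Gal}(L/k)=\langle\sigma\rangle$, where $L/\mathbb{Q}$ is Galois and $L$ is totally real or CM; let $x\mapsto x^*$ denote complex conjugation on $L$. Let $\gamma\in\mathcal{O}_k$ satisfy $\gamma\gamma^*=1$. Put $a^\sigma=\sigma^{-1}(a)$, and let $B=(\gamma,L/k,\sigma)=\bigoplus_{j=0}^{n-1}e^jL$ be the cyclic algebra with $e^n=\gamma$ and $ae=ea^\sigma$ for $a\in L$; let $\Lambda=\bigoplus_{j=0}^{n-1}e^j\mathcal{O}_L$, $\tau\bigl(\sum_j e^jx_j\bigr)=\sum_j x_j^*e^{-j}$ and $\mathrm{Trd}_B\bigl(\sum_j e^jx_j\bigr)=\mathrm{Tr}_{L/k}(x_0)$. Let $p$ be a prime number and $\mathfrak{p}$ a prime ideal of $\mathcal{O}_k$ above $p$ with $\mathfrak{p}^*=\mathfrak{p}$ which is totally ramified in $L$; let $\mathfrak{P}$ be the prime ideal of $\mathcal{O}_L$ above $\mathfrak{p}$, $\mathbb{F}_q=\mathcal{O}_L/\mathfrak{P}$, and let $\bar\sigma$ be the automorphism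 of $\mathbb{F}_q$ induced by $\sigma$. Let $\mathcal{P}=\Lambda\mathfrak{P}$, a two-sided ideal of $\Lambda$. Let $\lambda\in L\cap\mathbb{R}$ (that is, $\lambda^*=\lambda$) be totally positive with $\lambda\in\mathcal{D}_L^{-1}$, $\lambda\mathfrak{P}\subset p\mathcal{D}_L^{-1}$ and $p(\lambda\mathcal{D}_L)^{-1}\cap\mathcal{O}_L=\mathfrak{P}$, where $\mathcal{D}_L$ is the different of $L/\mathbb{Q}$. Consider on $\Lambda/\mathcal{P}$ the well-defined $\mathbb{F}_p$-bilinear form $$\varphi([x],[y])=\mathrm{Tr}_{k/\mathbb{Q}}\bigl(\mathrm{Trd}_B(\lambda\tau(x)y)\bigr)\bmod p,$$ and for a left ideal $\mathcal{J}$ of $\Lambda/\mathcal{P}$ put $\mathcal{J}^\perp=\{v:\varphi(u,v)=0\text{ for all }u\in\mathcal{J}\}$. Let $\mathbb{F}_q[X;\bar\sigma]$ be the skew-polynomial ring with $aX=X\,\bar\sigma^{-1}(a)$, and $\rho:\mathbb{F}_q[X;\bar\sigma]\to\Lambda/\mathcal{P}$ the ring morphism with $\rho(X)=[e]_{\mathcal{P}}$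 and $\rho([a]_{\mathfrak{P}})=[a]_{\mathcal{P}}$ for $a\in\mathcal{O}_L$. The left ideal of $\Lambda/\mathcal{P}$ corresponding to a monic divisor $\bar g$ of the central polynomial $X^n-[\gamma]_{\mathfrak{P}}$ is the one generated by $\rho(\bar g)$. Let $\bar g=\sum_{i=0}^d X^i[a_i]_{\mathfrak{P}}$ (with $a_i\in\mathcal{O}_L$ and $[a_d]_{\mathfrak{P}}=1$) be a monic divisor of $X^n-[\gamma]_{\mathfrak{P}}$ and let $\mathcal{J}$ be the corresponding left ideal. Then $[a_0^*]_{\mathfrak{P}}\neq0$, the polynomial $$\bar g_{\bar\tau}=\sum_{i=0}^d X^i[a_{d-i}^*]_{\mathfrak{P}}[a_0^*]_{\mathfrak{P}}^{-1}$$ is a monic divisor of $X^n-[\gamma]_{\mathfrak{P}}$, and $\mathcal{J}^\perp$ is the left ideal corresponding to the monic divisor $\bar h=(X^n-[\gamma]_{\mathfrak{P}})/\bar g_{\bar\tau}$ (that is, $\bar h\,\bar g_{\bar\tau}=\bar g_{\bar\tau}\,\bar h=X^n-[\gamma]_{\mathfrak{P}}$). Moreover, $\mathcal{J}\subset\mathcal{J}^\perp$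 if and only if $\bar g\,\bar g_{\bar\tau}$ is a multiple of $X^n-[\gamma]_{\mathfrak{P}}$, and $\mathcal{J}=\mathcal{J}^\perp$ if and only if $\bar g\,\bar g_{\bar\tau}=X^n-[\gamma]_{\mathfrak{P}}$. -/

import Mathlib

open NumberField

set_option linter.unusedSectionVars false

noncomputable section

/-- The underlying additive group of the cyclic algebra `(γ, L/k, σ) = ⨁_{j<n} e^j L`,
`n = [L : k]`: the element `∑ e^j x_j` is the family of its right coefficients `x_j`. -/
def CyclicAlgebra {k L : Type*} [Field k] [Field L] [Algebra k L]
    (_σ : L ≃ₐ[k] L) (_γ : k) : Type _ :=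
  Fin (Module.finrank k L) → L

namespace CyclicAlgebra

variable {k L : Type*} [Field k] [Field L] [Algebra k L] {σ : L ≃ₐ[k] L} {γ : k}

instance : AddCommGroup (CyclicAlgebra σ γ) :=
  inferInstanceAs (AddCommGroup (Fin (Module.finrank k L) → L))

/-- The right coefficient of `e^j`. -/
def coord (x : CyclicAlgebra σ γ) (j : Fin (Module.finrank k L)) : L := x j

/-- The element with prescribed right coefficients. -/
def ofCoord (x : Fin (Module.finrank k L) → L) : CyclicAlgebra σ γ := x

@[ext] theorem ext {x y : CyclicAlgebra σ γ} (h : ∀ j, x.coord j = y.coord j) : x = y := funext h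

@[simp] theorem coord_ofCoord (x : Fin (Module.finrank k L) → L) (j : Fin (Module.finrank k L)) :
    (ofCoord x : CyclicAlgebra σ γ).coord j = x j := rfl

@[simp] theorem coord_add (x y : CyclicAlgebra σ γ) (j : Fin (Module.finrank k L)) :
    (x + y).coord j = x.coord j + y.coord j := rfl

@[simp] theorem coord_neg (x : CyclicAlgebra σ γ) (j : Fin (Module.finrank k L)) :
    (-x).coord j = -x.coord j := rfl

@[simp] theorem coord_zero (j : Fin (Module.finrank k L)) :
    (0 : CyclicAlgebra σ γ).coord j = 0 := rfl

/-- `coord` as an additive map. -/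
def coordHom (σ : L ≃ₐ[k] L) (γ : k) (j : Fin (Module.finrank k L)) :
    CyclicAlgebra σ γ →+ L where
  toFun x := x.coord j
  map_zero' := rfl
  map_add' _ _ := rfl

theorem coord_sum {ι : Type*} (s : Finset ι) (f : ι → CyclicAlgebra σ γ)
    (j : Fin (Module.finrank k L)) : (∑ i ∈ s, f i).coord j = ∑ i ∈ s, (f i).coord j :=
  map_sum (coordHom σ γ j) f s

/-- The monomial `e^m a` for an arbitrary `m : ℕ`, reduced by `e^n = γ`:
`e^m a = e^(m mod n) γ^(m div n) a`. -/
def mono (σ : L ≃ₐ[k] L) (γ : k) (m : ℕ) : L →+ CyclicAlgebra σ γ where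
  toFun a := ofCoord fun r ↦ if m % Module.finrank k L = r then
    algebraMap k L γ ^ (m / Module.finrank k L) * a else 0
  map_zero' := by ext; simp
  map_add' a b := by ext r; simp only [coord_add, coord_ofCoord]; split_ifs <;> ring

theorem coord_mono (m : ℕ) (a : L) (r : Fin (Module.finrank k L)) :
    (mono σ γ m a).coord r = if m % Module.finrank k L = r then
    algebraMap k L γ ^ (m / Module.finrank k L) * a else 0 := rfl

/-- Multiplication: the biadditive extension of `(e^i a)(e^j b) = e^(i+j) σ^(-j)(a) b`, which
expresses `a e = e σ⁻¹(a)` and `e^n = γ`. -/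
instance : Mul (CyclicAlgebra σ γ) where
  mul x y := ∑ i : Fin (Module.finrank k L), ∑ j : Fin (Module.finrank k L), mono σ γ ((i : ℕ) + (j : ℕ))
    ((σ⁻¹ ^ (j : ℕ)) (x.coord i) * y.coord j)

instance : One (CyclicAlgebra σ γ) where
  one := mono σ γ 0 1

/-- The generator `e`. -/
def e (σ : L ≃ₐ[k] L) (γ : k) : CyclicAlgebra σ γ := mono σ γ 1 1

theorem mul_def (x y : CyclicAlgebra σ γ) :
    x * y = ∑ i : Fin (Module.finrank k L), ∑ j : Fin (Module.finrank k L), mono σ γ ((i : ℕ) + (j : ℕ))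
      ((σ⁻¹ ^ (j : ℕ)) (x.coord i) * y.coord j) := rfl

theorem one_def : (1 : CyclicAlgebra σ γ) = mono σ γ 0 1 := rfl

theorem sum_mono (x : CyclicAlgebra σ γ) : ∑ j : Fin (Module.finrank k L), mono σ γ (j : ℕ) (x.coord j) = x := by
  ext r
  rw [coord_sum, Finset.sum_eq_single r]
  · simp [coord_mono, Nat.mod_eq_of_lt r.2, Nat.div_eq_of_lt r.2]
  · intro b _ hb
    rw [coord_mono, if_neg]
    rw [Nat.mod_eq_of_lt b.2]
    exact fun h ↦ hb (Fin.ext h)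
  · simp

section Ring

variable [FiniteDimensional k L] [IsGalois k L]

theorem sigma_inv_pow_finrank_mul (m : ℕ) : σ⁻¹ ^ (Module.finrank k L * m) = 1 := by
  rw [← IsGalois.card_aut_eq_finrank k L, pow_mul, pow_card_eq_one', one_pow]

theorem sigma_inv_pow_mod (m : ℕ) : σ⁻¹ ^ (m % Module.finrank k L) = σ⁻¹ ^ m := by
  conv_rhs => rw [← Nat.mod_add_div m (Module.finrank k L), pow_add,
    sigma_inv_pow_finrank_mul, mul_one]

theorem mono_mod (m : ℕ) (a : L) :
    mono σ γ m a = mono σ γ (m % Module.finrank k L)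
      (algebraMap k L γ ^ (m / Module.finrank k L) * a) := by
  have hn : 0 < Module.finrank k L := Module.finrank_pos
  ext r
  simp [coord_mono, Nat.div_eq_of_lt (Nat.mod_lt m hn)]

theorem mono_add_mul_finrank (m l : ℕ) (a : L) :
    mono σ γ (m + Module.finrank k L * l) a = mono σ γ m (algebraMap k L γ ^ l * a) := by
  have hn : 0 < Module.finrank k L := Module.finrank_pos
  ext r
  simp only [coord_mono, Nat.add_mul_mod_self_left, Nat.add_mul_div_left _ _ hn, pow_add]
  split_ifs <;> ring

protected theorem right_distrib (x y z : CyclicAlgebra σ γ) : (x + y) * z = x * z + y * z := by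
  simp [mul_def, add_mul, Finset.sum_add_distrib]

protected theorem left_distrib (x y z : CyclicAlgebra σ γ) : x * (y + z) = x * y + x * z := by
  simp [mul_def, mul_add, Finset.sum_add_distrib]

/-- Multiplication as a biadditive map. -/
def mulHom (σ : L ≃ₐ[k] L) (γ : k) :
    CyclicAlgebra σ γ →+ CyclicAlgebra σ γ →+ CyclicAlgebra σ γ :=
  AddMonoidHom.mk' (fun x ↦ AddMonoidHom.mk' (fun y ↦ x * y) (CyclicAlgebra.left_distrib x))
    fun x y ↦ by ext z : 1; exact CyclicAlgebra.right_distrib x y z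

theorem mulHom_apply (x y : CyclicAlgebra σ γ) : mulHom σ γ x y = x * y := rfl

theorem mono_mul_mono (m l : ℕ) (a b : L) :
    mono σ γ m a * mono σ γ l b = mono σ γ (m + l) ((σ⁻¹ ^ l) a * b) := by
  have hn : 0 < Module.finrank k L := Module.finrank_pos
  rw [mul_def, Finset.sum_eq_single (⟨m % Module.finrank k L, Nat.mod_lt m hn⟩ : Fin _),
    Finset.sum_eq_single (⟨l % Module.finrank k L, Nat.mod_lt l hn⟩ : Fin _)]
  · simp only [coord_mono, if_true]
    have h1 : m + l = (m % Module.finrank k L + l % Module.finrank k L) +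
        Module.finrank k L * (m / Module.finrank k L + l / Module.finrank k L) := by
      have := Nat.mod_add_div m (Module.finrank k L)
      have := Nat.mod_add_div l (Module.finrank k L)
      rw [mul_add]; omega
    conv_rhs => rw [h1, mono_add_mul_finrank]
    rw [sigma_inv_pow_mod]
    congr 1
    rw [map_mul, map_pow, AlgEquiv.commutes, pow_add]
    ring
  · intro j _ hj
    rw [coord_mono l b j, if_neg (fun h ↦ hj (Fin.ext h.symm))]
    simp
  · simp
  · intro i _ hi
    refine Finset.sum_eq_zero fun j _ ↦ ?_
    rw [coord_mono, if_neg (fun h ↦ hi (Fin.ext h.symm))]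
    simp
  · simp

protected theorem mul_assoc (x y z : CyclicAlgebra σ γ) : x * y * z = x * (y * z) := by
  rw [← sum_mono x, ← sum_mono y, ← sum_mono z]
  simp only [← mulHom_apply, map_sum, AddMonoidHom.finsetSum_apply]
  refine Finset.sum_congr rfl fun i _ ↦ Finset.sum_congr rfl fun j _ ↦
    Finset.sum_congr rfl fun l _ ↦ ?_
  simp only [mulHom_apply, mono_mul_mono, map_mul, pow_add, add_assoc]
  rw [pow_mul_comm, AlgEquiv.mul_apply, mul_assoc]

protected theorem one_mul (x : CyclicAlgebra σ γ) : 1 * x = x := by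
  conv_lhs => rw [← sum_mono x]
  conv_rhs => rw [← sum_mono x]
  rw [one_def, ← mulHom_apply, map_sum]
  exact Finset.sum_congr rfl fun j _ ↦ by simp [mulHom_apply, mono_mul_mono]

protected theorem mul_one (x : CyclicAlgebra σ γ) : x * 1 = x := by
  conv_lhs => rw [← sum_mono x]
  conv_rhs => rw [← sum_mono x]
  rw [one_def, ← mulHom_apply, map_sum, AddMonoidHom.finsetSum_apply]
  exact Finset.sum_congr rfl fun j _ ↦ by simp [mulHom_apply, mono_mul_mono]

instance : Ring (CyclicAlgebra σ γ) :=
  { (inferInstance : AddCommGroup (CyclicAlgebra σ γ)),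
    (inferInstance : Mul (CyclicAlgebra σ γ)), (inferInstance : One (CyclicAlgebra σ γ)) with
    mul_assoc := CyclicAlgebra.mul_assoc
    one_mul := CyclicAlgebra.one_mul
    mul_one := CyclicAlgebra.mul_one
    left_distrib := CyclicAlgebra.left_distrib
    right_distrib := CyclicAlgebra.right_distrib
    zero_mul := fun x ↦ map_zero ((mulHom σ γ).flip x)
    mul_zero := fun x ↦ map_zero (mulHom σ γ x) }

/-- The inclusion `L ⊆ B`. -/
def incl (σ : L ≃ₐ[k] L) (γ : k) : L →+* CyclicAlgebra σ γ where
  toFun := mono σ γ 0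
  map_one' := rfl
  map_mul' a b := by simp [mono_mul_mono]
  map_zero' := map_zero _
  map_add' := map_add _

theorem incl_mul_e (a : L) : incl σ γ a * e σ γ = e σ γ * incl σ γ (σ⁻¹ a) := by
  simp [incl, e, mono_mul_mono]

theorem e_pow (m : ℕ) : e σ γ ^ m = mono σ γ m 1 := by
  induction m with
  | zero => rfl
  | succ m ih => rw [pow_succ, ih, e, mono_mul_mono]; simp

theorem e_pow_finrank : e σ γ ^ Module.finrank k L = incl σ γ (algebraMap k L γ) := by
  rw [e_pow, mono_mod]
  have hn : 0 < Module.finrank k L := Module.finrank_pos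
  simp [incl, Nat.div_self hn]

theorem e_pow_mul_incl (m : ℕ) (a : L) : e σ γ ^ m * incl σ γ a = mono σ γ m a := by
  rw [e_pow]; simp [incl, mono_mul_mono]

/-- The inverse `e⁻¹ = e^(n-1) γ⁻¹`. -/
def eInv (σ : L ≃ₐ[k] L) (γ : k) : CyclicAlgebra σ γ :=
  e σ γ ^ (Module.finrank k L - 1) * incl σ γ (algebraMap k L γ)⁻¹

theorem eInv_mul_e (hγ : γ ≠ 0) : eInv σ γ * e σ γ = 1 := by
  have hn : 0 < Module.finrank k L := Module.finrank_pos
  have h : algebraMap k L γ ≠ 0 := by simpa using hγ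
  rw [eInv, mul_assoc, incl_mul_e, ← mul_assoc, ← pow_succ, Nat.sub_add_cancel hn, e_pow_finrank,
    ← map_mul, ← map_inv₀, AlgEquiv.commutes, map_inv₀, mul_inv_cancel₀ h, map_one]

theorem e_mul_eInv (hγ : γ ≠ 0) : e σ γ * eInv σ γ = 1 := by
  have hn : 0 < Module.finrank k L := Module.finrank_pos
  have h : algebraMap k L γ ≠ 0 := by simpa using hγ
  rw [eInv, ← mul_assoc, ← pow_succ', Nat.sub_add_cancel hn, e_pow_finrank,
    ← map_mul, mul_inv_cancel₀ h, map_one]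

theorem eInv_pow (j : ℕ) : eInv σ γ ^ j =
    mono σ γ ((Module.finrank k L - 1) * j) (algebraMap k L (γ⁻¹ ^ j)) := by
  induction j with
  | zero => simp only [pow_zero, mul_zero, map_one]; rfl
  | succ j ih =>
    rw [pow_succ, ih, eInv, e_pow_mul_incl, mono_mul_mono, AlgEquiv.commutes, ← map_inv₀,
      ← map_mul, ← pow_succ, Nat.mul_succ]

theorem coord_zero_incl_mul (j i : Fin (Module.finrank k L)) (hγ : γ ≠ 0) (a b : L) :
    (incl σ γ a * eInv σ γ ^ (j : ℕ) * mono σ γ (i : ℕ) b).coord ⟨0, Module.finrank_pos⟩ =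
      if j = i then a * b else 0 := by
  have hn : 0 < Module.finrank k L := Module.finrank_pos
  have h : algebraMap k L γ ≠ 0 := by simpa using hγ
  rw [eInv_pow]
  change (mono σ γ 0 a * _ * _).coord _ = _
  rw [mono_mul_mono, mono_mul_mono, coord_mono]
  have hj := j.2
  have hi := i.2
  have hcong : (0 + (Module.finrank k L - 1) * (j : ℕ) + (i : ℕ)) + (j : ℕ) =
      Module.finrank k L * (j : ℕ) + (i : ℕ) := by
    have : (Module.finrank k L - 1) * (j : ℕ) + (j : ℕ) = Module.finrank k L * (j : ℕ) := by
      conv_lhs => rw [← Nat.succ_mul]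
      rw [Nat.succ_eq_add_one, Nat.sub_add_cancel hn]
    omega
  by_cases hji : j = i
  · subst hji
    have h1 : 0 + (Module.finrank k L - 1) * (j : ℕ) + (j : ℕ) =
        Module.finrank k L * (j : ℕ) := by omega
    rw [if_pos (by rw [h1]; simp), if_pos rfl, h1, Nat.mul_div_cancel_left _ hn, map_mul,
      AlgEquiv.commutes, ← AlgEquiv.mul_apply, ← pow_add]
    have h5 : (j : ℕ) + (Module.finrank k L - 1) * (j : ℕ) = Module.finrank k L * (j : ℕ) := by
      omega
    rw [h5, sigma_inv_pow_finrank_mul, AlgEquiv.one_apply, map_pow, map_inv₀]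
    have h6 := mul_inv_cancel₀ (pow_ne_zero (j : ℕ) h)
    rw [inv_pow]
    linear_combination (a * b) * h6
  · rw [if_neg hji, if_neg]
    intro h0
    apply hji
    have h2 : Module.finrank k L ∣ 0 + (Module.finrank k L - 1) * (j : ℕ) + (i : ℕ) :=
      Nat.dvd_of_mod_eq_zero h0
    obtain ⟨c, hc⟩ := h2
    apply Fin.ext
    have h3 : Module.finrank k L * c + (j : ℕ) = Module.finrank k L * (j : ℕ) + (i : ℕ) := by
      rw [← hc, hcong]
    have h4 := congrArg (· % Module.finrank k L) h3
    simpa [Nat.mul_add_mod, Nat.mod_eq_of_lt hj, Nat.mod_eq_of_lt hi] using h4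

/-- The reduced trace `Trd_B(∑ e^j x_j) = Tr_{L/k}(x_0)`. -/
def trd (x : CyclicAlgebra σ γ) : k :=
  Algebra.trace k L (x.coord ⟨0, Module.finrank_pos⟩)

end Ring

end CyclicAlgebra

section Conjugation

variable (L : Type*) [Field L] [NumberField L]

open scoped Classical in
/-- Complex conjugation `x ↦ x^*` on a number field that is CM or totally real
(in the second case it is the identity). -/
def conjL : L ≃+* L :=
  if h : IsCMField L then (@IsCMField.complexConj L _ _ h _).toRingEquiv else RingEquiv.refl L

variable {L}

theorem embedding_conjL (hL : IsTotallyReal L ∨ IsCMField L) (φ : L →+* ℂ) (x : L) :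
    φ (conjL L x) = (starRingEnd ℂ) (φ x) := by
  by_cases h : IsCMField L
  · have : conjL L x = IsCMField.complexConj L x := by simp [conjL, h]
    rw [this, IsCMField.complexEmbedding_complexConj]
  · have hr : IsTotallyReal L := hL.resolve_right h
    have : conjL L x = x := by simp [conjL, h]
    rw [this]
    have h := ComplexEmbedding.isReal_iff.mp (IsTotallyReal.complexEmbedding_isReal φ)
    exact (RingHom.congr_fun h x).symm

end Conjugation

/-- The standing data: a cyclic extension `L/k` of number fields with `L/ℚ` totally
real or CM, a generator `σ` of its Galois group, `γ ∈ 𝓞 k` with `γ γ^* = 1`, a totally positive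
`lam ∈ L ∩ ℝ` in the inverse different, a prime `𝔭 = 𝔭^*` of `k` above the prime number `p` which
is inert or totally ramified in `L`, the prime `𝔓` of `L` above it, and the two conditions under
which the trace form is well defined and nondegenerate modulo `𝔓`. -/
structure CyclicCodeData (k L : Type*) [Field k] [NumberField k] [Field L] [NumberField L]
    [Algebra k L] where
  real_or_cm : IsTotallyReal L ∨ IsCMField L
  σ : L ≃ₐ[k] L
  σ_generates : ∀ g : L ≃ₐ[k] L, g ∈ Subgroup.zpowers σ
  γ : 𝓞 k
  γ_mul_conj : algebraMap k L (γ : k) * conjL L (algebraMap k L (γ : k)) = 1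
  lam : L
  lam_real : conjL L lam = lam
  lam_pos : ∀ φ : L →+* ℂ, 0 < (φ lam).re
  lam_mem : lam ∈ ((differentIdeal ℤ (𝓞 L) : FractionalIdeal (nonZeroDivisors (𝓞 L)) L))⁻¹
  p : ℕ
  p_prime : p.Prime
  𝔭 : Ideal (𝓞 k)
  𝔭_prime : 𝔭.IsPrime
  p_mem : (p : 𝓞 k) ∈ 𝔭
  /-- `𝔭^* = 𝔭`, both sides being viewed inside `L`. -/
  𝔭_conj : (fun x : 𝓞 k ↦ conjL L (algebraMap k L (x : k))) '' (𝔭 : Set (𝓞 k)) =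
    (fun x : 𝓞 k ↦ algebraMap k L (x : k)) '' (𝔭 : Set (𝓞 k))
  𝔓 : Ideal (𝓞 L)
  𝔓_prime : 𝔓.IsPrime
  /-- `𝔭 𝓞_L` is `𝔓` (inert case) or `𝔓^n` (totally ramified case). -/
  inert_or_ramified : 𝔭.map (algebraMap (𝓞 k) (𝓞 L)) = 𝔓 ∨
    𝔭.map (algebraMap (𝓞 k) (𝓞 L)) = 𝔓 ^ Module.finrank k L
  /-- `lam 𝔓 ⊆ p 𝓓_L⁻¹`. -/
  lam_mul_le : FractionalIdeal.spanSingleton (nonZeroDivisors (𝓞 L)) lam *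
      (𝔓 : FractionalIdeal (nonZeroDivisors (𝓞 L)) L) ≤
    FractionalIdeal.spanSingleton (nonZeroDivisors (𝓞 L)) (p : L) *
      ((differentIdeal ℤ (𝓞 L) : FractionalIdeal (nonZeroDivisors (𝓞 L)) L))⁻¹
  /-- `p (lam 𝓓_L)⁻¹ ∩ 𝓞_L = 𝔓`. -/
  lam_nondegenerate : FractionalIdeal.spanSingleton (nonZeroDivisors (𝓞 L)) (p : L) *
      (FractionalIdeal.spanSingleton (nonZeroDivisors (𝓞 L)) lam *
        (differentIdeal ℤ (𝓞 L) : FractionalIdeal (nonZeroDivisors (𝓞 L)) L))⁻¹ ⊓ 1 =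
    (𝔓 : FractionalIdeal (nonZeroDivisors (𝓞 L)) L)

namespace CyclicCodeData

open CyclicAlgebra

variable {k L : Type*} [Field k] [NumberField k] [Field L] [NumberField L] [Algebra k L]
  (S : CyclicCodeData k L)

/-- The degree `n = [L : k]`. -/
abbrev n (_S : CyclicCodeData k L) : ℕ := Module.finrank k L

theorem γ_ne_zero : (S.γ : k) ≠ 0 := by
  intro h
  have := S.γ_mul_conj
  simp [h] at this

theorem exists_pow : ∃ m : ℕ, S.𝔭.map (algebraMap (𝓞 k) (𝓞 L)) = S.𝔓 ^ (m + 1) := by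
  have hn : 0 < Module.finrank k L := Module.finrank_pos
  rcases S.inert_or_ramified with h | h
  · exact ⟨0, by simpa using h⟩
  · exact ⟨Module.finrank k L - 1, by rw [Nat.sub_add_cancel hn]; exact h⟩

/-- The action of a `k`-automorphism of `L` on `𝓞 L`. -/
def autInt (_S : CyclicCodeData k L) (g : L ≃ₐ[k] L) : 𝓞 L ≃+* 𝓞 L :=
  RingOfIntegers.mapRingEquiv g.toRingEquiv

/-- Complex conjugation on `𝓞 L`. -/
def conjInt (_S : CyclicCodeData k L) : 𝓞 L ≃+* 𝓞 L := RingOfIntegers.mapRingEquiv (conjL L)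

theorem mem_of_map_le (f : 𝓞 L ≃+* 𝓞 L)
    (hf : ∀ y ∈ S.𝔭, f (algebraMap (𝓞 k) (𝓞 L) y) ∈ S.𝔭.map (algebraMap (𝓞 k) (𝓞 L)))
    {x : 𝓞 L} (hx : x ∈ S.𝔓) : f x ∈ S.𝔓 := by
  obtain ⟨m, hm⟩ := S.exists_pow
  have := S.𝔓_prime
  have h1 : S.𝔭.map (algebraMap (𝓞 k) (𝓞 L)) ≤
      (S.𝔭.map (algebraMap (𝓞 k) (𝓞 L))).comap f := by
    rw [Ideal.map_le_iff_le_comap]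
    intro y hy
    exact hf y hy
  have h2 : x ^ (m + 1) ∈ S.𝔭.map (algebraMap (𝓞 k) (𝓞 L)) := by
    rw [hm]; exact Ideal.pow_mem_pow hx _
  have h3 : f x ^ (m + 1) ∈ S.𝔭.map (algebraMap (𝓞 k) (𝓞 L)) := by
    have := h1 h2
    rwa [Ideal.mem_comap, map_pow] at this
  rw [hm] at h3
  exact this.mem_of_pow_mem _ (Ideal.pow_le_self (Nat.succ_ne_zero m) h3)

theorem autInt_mem (g : L ≃ₐ[k] L) {x : 𝓞 L} (hx : x ∈ S.𝔓) : S.autInt g x ∈ S.𝔓 := by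
  refine S.mem_of_map_le _ (fun y hy ↦ ?_) hx
  have : S.autInt g (algebraMap (𝓞 k) (𝓞 L) y) = algebraMap (𝓞 k) (𝓞 L) y := by
    apply RingOfIntegers.ext
    change g (algebraMap k L (y : k)) = algebraMap k L (y : k)
    exact g.commutes _
  rw [this]
  exact Ideal.mem_map_of_mem _ hy

theorem conjInt_mem {x : 𝓞 L} (hx : x ∈ S.𝔓) : S.conjInt x ∈ S.𝔓 := by
  refine S.mem_of_map_le _ (fun y hy ↦ ?_) hx
  have h : conjL L (algebraMap k L (y : k)) ∈
      (fun x : 𝓞 k ↦ algebraMap k L (x : k)) '' (S.𝔭 : Set (𝓞 k)) := by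
    rw [← S.𝔭_conj]; exact ⟨y, hy, rfl⟩
  obtain ⟨z, hz, hzy⟩ := h
  have : S.conjInt (algebraMap (𝓞 k) (𝓞 L) y) = algebraMap (𝓞 k) (𝓞 L) z := by
    apply RingOfIntegers.ext
    exact hzy.symm
  rw [this]
  exact Ideal.mem_map_of_mem _ hz

theorem p_mem_𝔓 : (S.p : 𝓞 L) ∈ S.𝔓 := by
  obtain ⟨m, hm⟩ := S.exists_pow
  have h : (S.p : 𝓞 L) ∈ S.𝔭.map (algebraMap (𝓞 k) (𝓞 L)) := by
    simpa using Ideal.mem_map_of_mem (algebraMap (𝓞 k) (𝓞 L)) S.p_mem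
  rw [hm] at h
  exact Ideal.pow_le_self (Nat.succ_ne_zero m) h

instance 𝔓_isMaximal : S.𝔓.IsMaximal := by
  have := S.𝔓_prime
  refine this.isMaximal fun h ↦ ?_
  have h1 := S.p_mem_𝔓
  rw [h, Ideal.mem_bot] at h1
  exact S.p_prime.ne_zero (by exact_mod_cast h1)

/-- The residue field `𝔽_q = 𝓞_L / 𝔓`. -/
def ResidueField : Type _ := 𝓞 L ⧸ S.𝔓

/-- The field structure of `𝓞_L / 𝔓`. -/
def residueFieldStructure : Field S.ResidueField := Ideal.Quotient.field S.𝔓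

instance : Field S.ResidueField := S.residueFieldStructure

/-- The class `[a]_𝔓`. -/
def res : 𝓞 L →+* S.ResidueField := Ideal.Quotient.mk S.𝔓

theorem res_surjective : Function.Surjective S.res := Ideal.Quotient.mk_surjective

/-- The automorphism of `𝓞_L / 𝔓` induced by `σ`. -/
def σBar : S.ResidueField →+* S.ResidueField :=
  Ideal.quotientMap S.𝔓 (S.autInt S.σ : 𝓞 L →+* 𝓞 L) fun _ hx ↦ S.autInt_mem S.σ hx

theorem σBar_res (a : 𝓞 L) : S.σBar (S.res a) = S.res (S.autInt S.σ a) := rfl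

/-- The twist `X a = σ̄(a) X`, equivalently `a X = X a^σ̄` with `a^σ̄ = σ̄⁻¹(a)`. -/
instance : MulSemiringAction (Multiplicative ℕ) S.ResidueField :=
  MulSemiringAction.compHom _ (powersHom (S.ResidueField →+* S.ResidueField) S.σBar)

/-- The skew-polynomial ring `𝔽_q[X; σ̄]`. -/
abbrev SkewPoly : Type _ := @SkewPolynomial S.ResidueField Semiring.toAddCommMonoid

theorem X_mul_C (a : S.ResidueField) :
    (SkewPolynomial.X : S.SkewPoly) * SkewPolynomial.C a =
      SkewPolynomial.C (S.σBar a) * SkewPolynomial.X := by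
  rw [SkewPolynomial.X, SkewPolynomial.monomial_mul_C, SkewPolynomial.C_mul_monomial]
  simp only [one_mul, mul_one, Function.iterate_one]
  congr 1

variable [IsGalois k L]

/-- The cyclic algebra `B = (γ, L/k, σ)`. -/
abbrev B : Type _ := CyclicAlgebra S.σ (S.γ : k)

/-- The involution `τ(∑ e^j x_j) = ∑ x_j^* e^(-j)` of `B`. -/
def τ (x : S.B) : S.B :=
  ∑ j : Fin S.n, incl S.σ (S.γ : k) (conjL L (x.coord j)) * eInv S.σ (S.γ : k) ^ (j : ℕ)

/-- The trace form `q_{B,lam}(x, y) = Tr_{k/ℚ}(Trd_B(lam τ(x) y))`. -/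
def traceForm (x y : S.B) : ℚ :=
  Algebra.trace ℚ k (trd (incl S.σ (S.γ : k) S.lam * S.τ x * y))

theorem coord_mul_mem (P Q R : AddSubgroup L) (hσ : ∀ a ∈ P, ∀ m : ℕ, (S.σ⁻¹ ^ m) a ∈ P)
    (h : ∀ a ∈ P, ∀ b ∈ Q, a * b ∈ R) (hγ : ∀ c ∈ R, algebraMap k L (S.γ : k) * c ∈ R)
    {x y : S.B} (hx : ∀ j, x.coord j ∈ P) (hy : ∀ j, y.coord j ∈ Q) (j : Fin S.n) :
    (x * y).coord j ∈ R := by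
  rw [CyclicAlgebra.mul_def, coord_sum]
  refine R.sum_mem fun i _ ↦ ?_
  rw [coord_sum]
  refine R.sum_mem fun l _ ↦ ?_
  rw [coord_mono]
  split_ifs
  · have key : ∀ (m : ℕ) (c : L), c ∈ R → algebraMap k L (S.γ : k) ^ m * c ∈ R := by
      intro m
      induction m with
      | zero => intro c hc; simpa using hc
      | succ m ih => intro c hc; rw [pow_succ, mul_assoc]; exact ih _ (hγ _ hc)
    exact key _ _ (h _ (hσ _ (hx i) _) _ (hy l))
  · exact R.zero_mem

/-- The integers of `L` as an additive subgroup of `L`. -/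
def intGroup (_S : CyclicCodeData k L) : AddSubgroup L :=
  (algebraMap (𝓞 L) L).range.toAddSubgroup

/-- `𝔓` as an additive subgroup of `L`. -/
def 𝔓Group : AddSubgroup L :=
  S.𝔓.toAddSubgroup.map (algebraMap (𝓞 L) L).toAddMonoidHom

theorem mem_intGroup {a : L} : a ∈ S.intGroup ↔ ∃ b : 𝓞 L, algebraMap (𝓞 L) L b = a := Iff.rfl

theorem mem_𝔓Group {a : L} : a ∈ S.𝔓Group ↔ ∃ b ∈ S.𝔓, algebraMap (𝓞 L) L b = a := Iff.rfl

theorem γ_eq : algebraMap k L (S.γ : k) = algebraMap (𝓞 L) L (algebraMap (𝓞 k) (𝓞 L) S.γ) := rfl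

theorem aut_intGroup (g : L ≃ₐ[k] L) {a : L} (ha : a ∈ S.intGroup) : g a ∈ S.intGroup := by
  obtain ⟨b, rfl⟩ := ha
  exact ⟨S.autInt g b, rfl⟩

theorem aut_𝔓Group (g : L ≃ₐ[k] L) {a : L} (ha : a ∈ S.𝔓Group) : g a ∈ S.𝔓Group := by
  obtain ⟨b, hb, rfl⟩ := ha
  exact ⟨S.autInt g b, S.autInt_mem g hb, rfl⟩

theorem int_mul_int {a b : L} (ha : a ∈ S.intGroup) (hb : b ∈ S.intGroup) :
    a * b ∈ S.intGroup := (algebraMap (𝓞 L) L).range.mul_mem ha hb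

theorem int_mul_𝔓 {a b : L} (ha : a ∈ S.intGroup) (hb : b ∈ S.𝔓Group) : a * b ∈ S.𝔓Group := by
  obtain ⟨a, rfl⟩ := ha
  obtain ⟨b, hb, rfl⟩ := hb
  exact ⟨a * b, S.𝔓.mul_mem_left a hb, map_mul (algebraMap (𝓞 L) L) _ _⟩

theorem γ_mem : algebraMap k L (S.γ : k) ∈ S.intGroup := ⟨_, S.γ_eq.symm⟩

theorem coord_mono_mem (R : AddSubgroup L) (m : ℕ) {a : L} (ha : a ∈ R)
    (hγ : ∀ c ∈ R, algebraMap k L (S.γ : k) * c ∈ R) (j : Fin S.n) :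
    (mono S.σ (S.γ : k) m a).coord j ∈ R := by
  rw [coord_mono]
  split_ifs
  · have key : ∀ (m : ℕ) (c : L), c ∈ R → algebraMap k L (S.γ : k) ^ m * c ∈ R := by
      intro m
      induction m with
      | zero => intro c hc; simpa using hc
      | succ m ih => intro c hc; rw [pow_succ, mul_assoc]; exact ih _ (hγ _ hc)
    exact key _ _ ha
  · exact R.zero_mem

/-- The order `Λ = ⨁_{j<n} e^j 𝓞_L` of `B`. -/
def Λ : Subring S.B where
  carrier := {x | ∀ j, ∃ b : 𝓞 L, algebraMap (𝓞 L) L b = x.coord j}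
  zero_mem' _ := ⟨0, map_zero _⟩
  one_mem' := S.coord_mono_mem S.intGroup 0 ⟨1, map_one _⟩ fun _ ↦ S.int_mul_int S.γ_mem
  add_mem' hx hy j := S.intGroup.add_mem (hx j) (hy j)
  neg_mem' hx j := S.intGroup.neg_mem (hx j)
  mul_mem' := S.coord_mul_mem S.intGroup S.intGroup S.intGroup
    (fun _ ha _ ↦ S.aut_intGroup _ ha) (fun _ ha _ hb ↦ S.int_mul_int ha hb)
    (fun _ ↦ S.int_mul_int S.γ_mem)

/-- The element `e` of `Λ`. -/
def eΛ : S.Λ := ⟨e S.σ (S.γ : k),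
  S.coord_mono_mem S.intGroup 1 ⟨1, map_one _⟩ fun _ ↦ S.int_mul_int S.γ_mem⟩

/-- The inclusion `𝓞_L ⊆ Λ`. -/
def inclΛ : 𝓞 L →+* S.Λ :=
  ((incl S.σ (S.γ : k)).comp (algebraMap (𝓞 L) L)).codRestrict S.Λ fun a ↦
    S.coord_mono_mem S.intGroup 0 ⟨a, rfl⟩ fun _ ↦ S.int_mul_int S.γ_mem

/-- The left ideal `𝒫 = Λ𝔓` of `Λ`. -/
def PΛ : Ideal S.Λ := Ideal.span (S.inclΛ '' (S.𝔓 : Set (𝓞 L)))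

theorem mem_PΛ {x : S.Λ} : x ∈ S.PΛ ↔ ∀ j, (x : S.B).coord j ∈ S.𝔓Group := by
  constructor
  · intro hx
    refine Submodule.span_induction (p := fun (x : S.Λ) _ ↦ ∀ j, (x : S.B).coord j ∈ S.𝔓Group)
      ?_ ?_ ?_ ?_ hx
    · rintro _ ⟨a, ha, rfl⟩ j
      exact S.coord_mono_mem S.𝔓Group 0 ⟨a, ha, rfl⟩ (fun _ ↦ S.int_mul_𝔓 S.γ_mem) j
    · intro j; exact S.𝔓Group.zero_mem
    · intro x y _ _ hx hy j; exact S.𝔓Group.add_mem (hx j) (hy j)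
    · intro a x _ hx j
      exact S.coord_mul_mem S.intGroup S.𝔓Group S.𝔓Group (fun _ ha _ ↦ S.aut_intGroup _ ha)
        (fun _ ha _ hb ↦ S.int_mul_𝔓 ha hb) (fun _ ↦ S.int_mul_𝔓 S.γ_mem) a.2 hx j
  · intro hx
    choose b hb hbx using hx
    have : x = ∑ j : Fin S.n, S.eΛ ^ (j : ℕ) * S.inclΛ (b j) := by
      apply Subtype.ext
      rw [AddSubmonoidClass.coe_finsetSum]
      conv_lhs => rw [← sum_mono (x : S.B)]
      refine Finset.sum_congr rfl fun j _ ↦ ?_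
      rw [← hbx]
      exact (e_pow_mul_incl _ _).symm
    rw [this]
    exact Submodule.sum_mem _ fun j _ ↦
      S.PΛ.mul_mem_left _ (Ideal.subset_span ⟨b j, hb j, rfl⟩)

instance : S.PΛ.IsTwoSided where
  mul_mem_of_left b ha := by
    rw [mem_PΛ] at ha ⊢
    exact S.coord_mul_mem S.𝔓Group S.intGroup S.𝔓Group (fun _ ha _ ↦ S.aut_𝔓Group _ ha)
        (fun a ha b hb ↦ mul_comm b a ▸ S.int_mul_𝔓 hb ha) (fun _ ↦ S.int_mul_𝔓 S.γ_mem) ha b.2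

/-- The quotient ring `Λ/𝒫`. -/
abbrev QuotRing : Type _ := S.Λ ⧸ S.PΛ

/-- The class `[x]_𝒫`. -/
def cls : S.Λ →+* S.QuotRing := Ideal.Quotient.mk S.PΛ

/-- The ring morphism `𝓞_L/𝔓 → Λ/𝒫`, `[a]_𝔓 ↦ [a]_𝒫`. -/
def inclRes : S.ResidueField →+* S.QuotRing :=
  Ideal.Quotient.lift S.𝔓 (S.cls.comp S.inclΛ) fun a ha ↦
    Ideal.Quotient.eq_zero_iff_mem.mpr (Ideal.subset_span ⟨a, ha, rfl⟩)

theorem eΛ_mul_inclΛ (a : 𝓞 L) : S.eΛ * S.inclΛ a = S.inclΛ (S.autInt S.σ a) * S.eΛ := by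
  apply Subtype.ext
  change e S.σ (S.γ : k) * incl _ _ (algebraMap (𝓞 L) L a) =
    incl _ _ (S.σ (algebraMap (𝓞 L) L a)) * e S.σ (S.γ : k)
  rw [incl_mul_e]
  simp

theorem inclRes_σBar_pow_mul (m : ℕ) (x : S.ResidueField) :
    S.inclRes ((S.σBar ^ m) x) * S.cls S.eΛ ^ m = S.cls S.eΛ ^ m * S.inclRes x := by
  induction m generalizing x with
  | zero => simp
  | succ m ih =>
    obtain ⟨a, rfl⟩ := S.res_surjective x
    have h1 : S.cls S.eΛ * S.inclRes (S.res a) =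
        S.inclRes (S.σBar (S.res a)) * S.cls S.eΛ := by
      change S.cls S.eΛ * S.cls (S.inclΛ a) = S.cls (S.inclΛ (S.autInt S.σ a)) * S.cls S.eΛ
      rw [← map_mul, ← map_mul, eΛ_mul_inclΛ]
    rw [pow_succ (S.cls S.eΛ), mul_assoc _ _ (S.inclRes (S.res a)), h1,
      ← mul_assoc (S.cls S.eΛ ^ m), ← ih, mul_assoc, ← pow_succ, pow_succ S.σBar]
    rfl

/-- The ring morphism `ρ : 𝔽_q[X; σ̄] → Λ/𝒫` with `X ↦ [e]_𝒫` and `[a]_𝔓 ↦ [a]_𝒫`. -/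
def ρ : S.SkewPoly →+* S.QuotRing :=
  SkewMonoidAlgebra.liftNCRingHom S.inclRes (powersHom S.QuotRing (S.cls S.eΛ))
    fun {x y} ↦ S.inclRes_σBar_pow_mul y.toAdd x

theorem ρ_X : S.ρ SkewPolynomial.X = S.cls S.eΛ := by
  simp [ρ, SkewMonoidAlgebra.liftNCRingHom, SkewPolynomial.X, SkewPolynomial.monomial_def]

theorem ρ_C (a : 𝓞 L) : S.ρ (SkewPolynomial.C (S.res a)) = S.cls (S.inclΛ a) := by
  change SkewMonoidAlgebra.liftNC _ _ (SkewMonoidAlgebra.single _ _) = _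
  rw [SkewMonoidAlgebra.liftNC_single]
  simp
  rfl

/-! The trace form modulo `p`. -/

theorem traceForm_eq (x y : S.B) : S.traceForm x y =
    ∑ j : Fin S.n, Algebra.trace ℚ L (S.lam * conjL L (x.coord j) * y.coord j) := by
  have h : (incl S.σ (S.γ : k) S.lam * S.τ x * y).coord ⟨0, Module.finrank_pos⟩ =
      ∑ j : Fin S.n, S.lam * conjL L (x.coord j) * y.coord j := by
    conv_lhs => rw [← sum_mono y]
    rw [Finset.mul_sum, coord_sum]
    refine Finset.sum_congr rfl fun i _ ↦ ?_
    rw [τ, Finset.mul_sum, Finset.sum_mul, coord_sum, Finset.sum_eq_single i]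
    · rw [← mul_assoc, ← map_mul, coord_zero_incl_mul _ _ S.γ_ne_zero, if_pos rfl]
    · intro j _ hj
      rw [← mul_assoc, ← map_mul, coord_zero_incl_mul _ _ S.γ_ne_zero, if_neg hj]
    · simp
  rw [traceForm, trd, h, Algebra.trace_trace, map_sum]

theorem exists_trace_int {c a : L}
    (hc : c ∈ ((differentIdeal ℤ (𝓞 L) : FractionalIdeal (nonZeroDivisors (𝓞 L)) L))⁻¹)
    (ha : a ∈ S.intGroup) : ∃ m : ℤ, Algebra.trace ℚ L (c * a) = m := by
  rw [coeIdeal_differentIdeal ℤ ℚ, inv_inv, FractionalIdeal.mem_dual (one_ne_zero (α := FractionalIdeal (nonZeroDivisors (𝓞 L)) L))] at hc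
  obtain ⟨b, rfl⟩ := ha
  obtain ⟨m, hm⟩ := hc (algebraMap (𝓞 L) L b) (FractionalIdeal.coe_mem_one _ b)
  exact ⟨m, by rw [← Algebra.traceForm_apply, ← hm]; simp⟩

theorem conj_intGroup {a : L} (ha : a ∈ S.intGroup) : conjL L a ∈ S.intGroup := by
  obtain ⟨b, rfl⟩ := ha
  exact ⟨S.conjInt b, rfl⟩

theorem conj_𝔓Group {a : L} (ha : a ∈ S.𝔓Group) : conjL L a ∈ S.𝔓Group := by
  obtain ⟨b, hb, rfl⟩ := ha
  exact ⟨S.conjInt b, S.conjInt_mem hb, rfl⟩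

theorem exists_trace_p_mul {a : L} (ha : a ∈ S.𝔓Group) :
    ∃ m : ℤ, Algebra.trace ℚ L (S.lam * a) = S.p * m := by
  obtain ⟨b, hb, rfl⟩ := ha
  have h := S.lam_mul_le (FractionalIdeal.mul_mem_mul
    (FractionalIdeal.mem_spanSingleton_self (nonZeroDivisors (𝓞 L)) S.lam)
    (FractionalIdeal.mem_coeIdeal_of_mem (nonZeroDivisors (𝓞 L)) hb))
  obtain ⟨c, hc, hcb⟩ := FractionalIdeal.mem_singleton_mul.mp h
  obtain ⟨m, hm⟩ := S.exists_trace_int hc (a := 1) ⟨1, map_one _⟩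
  refine ⟨m, ?_⟩
  change Algebra.trace ℚ L (S.lam * algebraMap (𝓞 L) L b) = _
  rw [hcb, ← hm, mul_one, ← nsmul_eq_mul, map_nsmul, nsmul_eq_mul]

/-- The integrality of the trace form on `Λ`. -/
theorem exists_traceForm_int (x y : S.Λ) : ∃ m : ℤ, S.traceForm (x : S.B) y = m := by
  have h : ∀ j, ∃ m : ℤ, Algebra.trace ℚ L
      (S.lam * conjL L ((x : S.B).coord j) * (y : S.B).coord j) = m := fun j ↦ by
    rw [mul_assoc]
    exact S.exists_trace_int S.lam_mem (S.int_mul_int (S.conj_intGroup (x.2 j)) (y.2 j))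
  choose m hm using h
  exact ⟨∑ j, m j, by rw [traceForm_eq]; push_cast; exact Finset.sum_congr rfl fun j _ ↦ hm j⟩

/-- The integer `Tr_{k/ℚ}(Trd_B(lam τ(x) y))` for `x, y ∈ Λ`. -/
def traceFormInt (x y : S.Λ) : ℤ := (S.exists_traceForm_int x y).choose

theorem traceFormInt_spec (x y : S.Λ) : S.traceForm (x : S.B) y = S.traceFormInt x y :=
  (S.exists_traceForm_int x y).choose_spec

theorem traceFormInt_add_left (x x' y : S.Λ) :
    S.traceFormInt (x + x') y = S.traceFormInt x y + S.traceFormInt x' y := by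
  have h : (S.traceFormInt (x + x') y : ℚ) = S.traceFormInt x y + S.traceFormInt x' y := by
    simp only [← traceFormInt_spec, traceForm_eq, ← Finset.sum_add_distrib, ← map_add]
    refine Finset.sum_congr rfl fun j _ ↦ congrArg _ ?_
    rw [Subring.coe_add, coord_add, map_add]
    ring
  exact_mod_cast h

theorem traceFormInt_add_right (x y y' : S.Λ) :
    S.traceFormInt x (y + y') = S.traceFormInt x y + S.traceFormInt x y' := by
  have h : (S.traceFormInt x (y + y') : ℚ) = S.traceFormInt x y + S.traceFormInt x y' := by
    simp only [← traceFormInt_spec, traceForm_eq, ← Finset.sum_add_distrib, ← map_add]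
    refine Finset.sum_congr rfl fun j _ ↦ congrArg _ ?_
    rw [Subring.coe_add, coord_add]
    ring
  exact_mod_cast h

theorem p_dvd_traceFormInt (x y : S.Λ) (h : x ∈ S.PΛ ∨ y ∈ S.PΛ) :
    (S.p : ℤ) ∣ S.traceFormInt x y := by
  have h : ∀ j, ∃ m : ℤ, Algebra.trace ℚ L
      (S.lam * conjL L ((x : S.B).coord j) * (y : S.B).coord j) = S.p * m := fun j ↦ by
    rw [mul_assoc]
    apply S.exists_trace_p_mul
    rcases h with h | h
    · rw [mul_comm]
      exact S.int_mul_𝔓 (y.2 j) (S.conj_𝔓Group (S.mem_PΛ.mp h j))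
    · exact S.int_mul_𝔓 (S.conj_intGroup (x.2 j)) (S.mem_PΛ.mp h j)
  choose m hm using h
  refine ⟨∑ j, m j, ?_⟩
  have : (S.traceFormInt x y : ℚ) = S.p * ∑ j, (m j : ℚ) := by
    rw [← traceFormInt_spec, traceForm_eq, Finset.mul_sum]
    exact Finset.sum_congr rfl fun j _ ↦ hm j
  exact_mod_cast this

/-- The bilinear form `φ([x]_𝒫, [y]_𝒫) = [Tr_{k/ℚ}(Trd_B(lam τ(x) y))]_p` on `Λ/𝒫`. -/
def φ (u v : S.QuotRing) : ZMod S.p :=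
  Quotient.liftOn₂' u v (fun x y ↦ (S.traceFormInt x y : ZMod S.p)) (by
    intro x y x' y' hx hy
    rw [Submodule.quotientRel_def] at hx hy
    rw [ZMod.intCast_eq_intCast_iff_dvd_sub]
    have h1 := S.traceFormInt_add_left (x - x') x' y
    have h2 := S.traceFormInt_add_right x' (y - y') y'
    rw [sub_add_cancel] at h1 h2
    have h3 : S.traceFormInt x' y' - S.traceFormInt x y =
        -(S.traceFormInt (x - x') y + S.traceFormInt x' (y - y')) := by
      rw [h1, h2]; ring
    rw [h3, dvd_neg]
    exact dvd_add (S.p_dvd_traceFormInt _ _ (Or.inl hx)) (S.p_dvd_traceFormInt _ _ (Or.inr hy)))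

theorem φ_cls (x y : S.Λ) : S.φ (S.cls x) (S.cls y) = (S.traceFormInt x y : ZMod S.p) := rfl

/-- The orthogonal `J^⊥` of a left ideal of `Λ/𝒫`. -/
def perp (J : Ideal S.QuotRing) : Set S.QuotRing := {v | ∀ u ∈ J, S.φ u v = 0}

/-- The left ideal of `Λ/𝒫` corresponding to a skew polynomial `g`, generated by
`[g(e)]_𝒫 = ρ(g)`. -/
def leftIdeal (g : S.SkewPoly) : Ideal S.QuotRing := Ideal.span {S.ρ g}

/-- The skew polynomial `∑_{i ≤ d} X^i c_i`. -/
def poly (d : ℕ) (c : ℕ → S.ResidueField) : S.SkewPoly :=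
  ∑ i ∈ Finset.range (d + 1), SkewPolynomial.X ^ i * SkewPolynomial.C (c i)

/-- A skew polynomial `∑_{i ≤ d} X^i c_i` with `c_d = 1`. -/
def IsMonic (g : S.SkewPoly) : Prop :=
  ∃ (d : ℕ) (c : ℕ → S.ResidueField), c d = 1 ∧ g = S.poly d c

/-- The central polynomial `X^n - [γ]_𝔓`. -/
def modulus : S.SkewPoly :=
  SkewPolynomial.X ^ S.n - SkewPolynomial.C (S.res (algebraMap (𝓞 k) (𝓞 L) S.γ))

/-- For `g = ∑_{i ≤ d} X^i [a_i]_𝔓`, the polynomial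
`g_τ = ∑_{i ≤ d} X^i [a_{d-i}^*]_𝔓 [a_0^*]_𝔓⁻¹`. -/
def polyτ (d : ℕ) (a : ℕ → 𝓞 L) : S.SkewPoly :=
  S.poly d fun i ↦ S.res (S.conjInt (a (d - i))) * (S.res (S.conjInt (a 0)))⁻¹

end CyclicCodeData

end

noncomputable section

/-! Total ramification makes the residue fields of `𝔭` and `𝔓` coincide, so `σ̄` is trivial
(`σBar_eq_id`). The skew-polynomial ring is then an ordinary polynomial ring, and `Λ/𝒫` is the
commutative ring `𝔽_q[X]/(X^n - γ)` (`evalE_surjective`, `evalE_eq_zero_iff`).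

In coordinates the form is `∑ Tr(λ x_j^* y_j)` mod `p`. Multiplication by `e` is an isometry because
`γ γ^* = 1`, and multiplication by `a` has adjoint multiplication by `a^*`. Hence multiplication by
`g(e)` has adjoint `e^(-d) N(e)`, where `N = X^d g^*(1/X)` is the conjugate reciprocal of `g`
(`φ_evalE_mul`). The form is nondegenerate (`φ_nondegenerate`) and `e` is a unit, so `J^⊥` is the
annihilator of `N(e)` (`mem_perp_iff`).

Applying conjugation and reversal to a factorization of `X^n - γ` gives `N ∣ X^n - γ`, again because
`γ γ^* = 1`. The monic normalization of `N` is `g_τ`. If `X^n - γ = g_τ h`, the annihilator of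
`N(e)` is generated by `h(e)`. The two self-orthogonality criteria become `h ∣ g` and `h = g`,
multiplied through by `g_τ`. -/

theorem conjL_conjL {L : Type*} [Field L] [NumberField L] (hL : IsTotallyReal L ∨ IsCMField L)
    (x : L) : conjL L (conjL L x) = x := by
  obtain ⟨φ⟩ : Nonempty (L →+* ℂ) := inferInstance
  apply φ.injective
  simp [embedding_conjL hL]

/-! ### The residue field under total ramification, and the trace condition defining `𝔓`. -/

namespace CyclicCodeData

open CyclicAlgebra

variable {k L : Type*} [Field k] [NumberField k] [Field L] [NumberField L] [Algebra k L]
  (S : CyclicCodeData k L)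

/-- If `𝔭 𝓞_L = 𝔓^n`, every residue class modulo `𝔓` is represented by an element of `𝓞_k`. -/
theorem exists_res_algebraMap
    (hram : S.𝔭.map (algebraMap (𝓞 k) (𝓞 L)) = S.𝔓 ^ Module.finrank k L) (x : S.ResidueField) :
    ∃ b : 𝓞 k, S.res (algebraMap (𝓞 k) (𝓞 L) b) = x := by
  have hn : Module.finrank k L ≠ 0 := Module.finrank_pos.ne'
  have hfr : Module.finrank (𝓞 k) (𝓞 L) = Module.finrank k L :=
    (IsFractionRing.finrank_eq (𝓞 k) k (𝓞 L) L).symm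
  -- Taking norms in `𝔭 𝓞_L = 𝔓^n` gives `N(𝔓)^n = N(𝔭)^n`. Equal cardinalities then make the
  -- injection of residue fields bijective.
  have hcard : Nat.card (𝓞 L ⧸ S.𝔓) = Nat.card (𝓞 k ⧸ S.𝔭) := by
    have h := Ideal.absNorm_algebraMap (𝓞 k) (𝓞 L) S.𝔭
    rw [hram, map_pow, hfr] at h
    exact Nat.pow_left_injective hn h
  have hle : S.𝔭 ≤ S.𝔓.comap (algebraMap (𝓞 k) (𝓞 L)) := by
    rw [← Ideal.map_le_iff_le_comap, hram]
    exact Ideal.pow_le_self hn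
  have h𝔭0 : S.𝔭 ≠ ⊥ := fun h ↦ S.p_prime.ne_zero (by
    have := S.p_mem
    rw [h, Ideal.mem_bot] at this
    exact_mod_cast this)
  have h𝔓0 : S.𝔓 ≠ ⊥ := fun h ↦ S.p_prime.ne_zero (by
    have := S.p_mem_𝔓
    rw [h, Ideal.mem_bot] at this
    exact_mod_cast this)
  have hmax : S.𝔭.IsMaximal := S.𝔭_prime.isMaximal h𝔭0
  have : Finite (𝓞 L ⧸ S.𝔓) := Ideal.finiteQuotientOfFreeOfNeBot _ h𝔓0
  let f : 𝓞 k ⧸ S.𝔭 →+* 𝓞 L ⧸ S.𝔓 := Ideal.quotientMap S.𝔓 (algebraMap (𝓞 k) (𝓞 L)) hle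
  let _ : Field (𝓞 k ⧸ S.𝔭) := Ideal.Quotient.field S.𝔭
  have hinj : Function.Injective f := RingHom.injective f
  have hbij : Function.Bijective f :=
    (Nat.bijective_iff_injective_and_card f).mpr ⟨hinj, hcard.symm⟩
  obtain ⟨y, hy⟩ := hbij.2 x
  obtain ⟨b, rfl⟩ := Ideal.Quotient.mk_surjective y
  exact ⟨b, hy⟩

/-- Every residue class has a representative in `𝓞_k`, which `σ` fixes. -/
theorem σBar_eq_id
    (hram : S.𝔭.map (algebraMap (𝓞 k) (𝓞 L)) = S.𝔓 ^ Module.finrank k L) (x : S.ResidueField) :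
    S.σBar x = x := by
  obtain ⟨b, rfl⟩ := S.exists_res_algebraMap hram x
  rw [σBar_res]
  congr 1
  apply RingOfIntegers.ext
  exact S.σ.commutes _

/-- The automorphism of `𝓞_L / 𝔓` induced by complex conjugation. -/
def conjBar : S.ResidueField →+* S.ResidueField :=
  Ideal.quotientMap S.𝔓 (S.conjInt : 𝓞 L →+* 𝓞 L) fun _ hx ↦ S.conjInt_mem hx

theorem conjBar_res (a : 𝓞 L) : S.conjBar (S.res a) = S.res (S.conjInt a) := rfl

/-- The relation `γ γ^* = 1` survives modulo `𝔓`. It makes `e` a unit, keeps constant terms of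
divisors of `X^n - γ` nonzero, and makes `X^n - γ` self-reciprocal up to a unit. -/
theorem res_γ_mul_conjBar : S.res (algebraMap (𝓞 k) (𝓞 L) S.γ) *
    S.conjBar (S.res (algebraMap (𝓞 k) (𝓞 L) S.γ)) = 1 := by
  rw [conjBar_res, ← map_mul, ← map_one S.res]
  congr 1
  exact RingOfIntegers.ext S.γ_mul_conj

theorem lam_ne_zero : S.lam ≠ 0 := by
  obtain ⟨φ⟩ : Nonempty (L →+* ℂ) := inferInstance
  intro h
  simpa [h] using S.lam_pos φ

/-- The hypothesis says that `λ a / p` has integral trace against all of `𝓞_L`, so it lies in the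
inverse different. Thus `a` lies in `p (λ 𝓓_L)⁻¹ ∩ 𝓞_L`, which is `𝔓` by assumption. -/
theorem mem_𝔓_of_trace {a : 𝓞 L}
    (ha : ∀ w : 𝓞 L, ∃ m : ℤ, Algebra.trace ℚ L (S.lam * w * a) = S.p * m) : a ∈ S.𝔓 := by
  have hp : (S.p : L) ≠ 0 := by exact_mod_cast S.p_prime.ne_zero
  have hpq : (S.p : ℚ) ≠ 0 := by exact_mod_cast S.p_prime.ne_zero
  have h1 : S.lam * a / S.p ∈
      ((differentIdeal ℤ (𝓞 L) : FractionalIdeal (nonZeroDivisors (𝓞 L)) L))⁻¹ := by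
    rw [coeIdeal_differentIdeal ℤ ℚ, inv_inv, FractionalIdeal.mem_dual
      (one_ne_zero (α := FractionalIdeal (nonZeroDivisors (𝓞 L)) L))]
    intro b hb
    obtain ⟨w, rfl⟩ := (FractionalIdeal.mem_one_iff _).mp hb
    obtain ⟨m, hm⟩ := ha w
    refine ⟨m, ?_⟩
    rw [Algebra.traceForm_apply]
    have h2 : S.lam * a / S.p * algebraMap (𝓞 L) L w = (S.p : ℚ)⁻¹ • (S.lam * w * a) := by
      rw [Algebra.smul_def]
      simp
      field_simp
    rw [h2, map_smul, hm]
    simp [hpq]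
  have h3 : algebraMap (𝓞 L) L a ∈ (S.𝔓 : FractionalIdeal (nonZeroDivisors (𝓞 L)) L) := by
    rw [← S.lam_nondegenerate, ← FractionalIdeal.mem_coe, FractionalIdeal.coe_inf]
    refine ⟨?_, FractionalIdeal.coe_mem_one _ a⟩
    rw [mul_inv, FractionalIdeal.spanSingleton_inv]
    have h4 : algebraMap (𝓞 L) L a = S.p * (S.lam⁻¹ * (S.lam * a / S.p)) := by
      field_simp [S.lam_ne_zero]
    rw [h4]
    exact FractionalIdeal.mul_mem_mul (FractionalIdeal.mem_spanSingleton_self _ _)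
      (FractionalIdeal.mul_mem_mul (FractionalIdeal.mem_spanSingleton_self _ _) h1)
  obtain ⟨b, hb, hba⟩ := (FractionalIdeal.mem_coeIdeal _).mp h3
  rwa [← RingOfIntegers.ext (hba : (b : L) = a)]

/-! ### Adjunction and nondegeneracy of the trace form. -/

variable [IsGalois k L]

/-- Coefficients stand to the right of `e^j`, so right multiplication by `a` scales each coordinate
by `a` with no twist. The conjugate `a^*` then moves across inside each summand. -/
theorem traceForm_mul_incl (x y : S.B) (a : L) :
    S.traceForm (x * incl S.σ (S.γ : k) a) y =
      S.traceForm x (y * incl S.σ (S.γ : k) (conjL L a)) := by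
  have h : ∀ (z : S.B) (b : L) (j : Fin S.n),
      (z * incl S.σ (S.γ : k) b).coord j = z.coord j * b := fun z b j ↦ by
    conv_lhs => rw [← sum_mono z]
    rw [Finset.sum_mul, coord_sum]
    have : ∀ i : Fin S.n, mono S.σ (S.γ : k) (i : ℕ) (z.coord i) * incl S.σ (S.γ : k) b =
        mono S.σ (S.γ : k) (i : ℕ) (z.coord i * b) := fun i ↦ by
      simp [incl, mono_mul_mono]
    rw [Finset.sum_congr rfl fun i _ ↦ by rw [this i], Finset.sum_eq_single j]
    · simp [coord_mono, Nat.mod_eq_of_lt j.2, Nat.div_eq_of_lt j.2]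
    · intro i _ hi
      rw [coord_mono, if_neg]
      rw [Nat.mod_eq_of_lt i.2]
      exact fun h ↦ hi (Fin.ext h)
    · simp
  rw [traceForm_eq, traceForm_eq]
  refine Finset.sum_congr rfl fun j _ ↦ ?_
  rw [h, h, map_mul (conjL L)]
  congr 1
  ring

/-- Left multiplication by `e` shifts the coordinates cyclically, with a factor `γ` on wrapping
around. That factor contributes `γ^* γ = 1` to the form. -/
theorem traceForm_e_mul (x y : S.B) :
    S.traceForm (e S.σ (S.γ : k) * x) (e S.σ (S.γ : k) * y) = S.traceForm x y := by
  have hn : 0 < S.n := Module.finrank_pos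
  -- The cyclic shift of indices. The exponent `(i + 1) / n` below is 1 for `i = n - 1` and 0
  -- otherwise.
  let s : Fin S.n → Fin S.n := fun i ↦ ⟨((i : ℕ) + 1) % S.n, Nat.mod_lt _ hn⟩
  have hs : Function.Injective s := fun i j hij ↦ by
    have h : (i : ℕ) + 1 ≡ j + 1 [MOD S.n] := congrArg Fin.val hij
    exact Fin.ext (Nat.ModEq.eq_of_lt_of_lt (Nat.ModEq.add_right_cancel' 1 h) i.2 j.2)
  have h : ∀ (z : S.B) (i : Fin S.n), (e S.σ (S.γ : k) * z).coord (s i) =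
      algebraMap k L (S.γ : k) ^ (((i : ℕ) + 1) / S.n) * z.coord i := fun z i ↦ by
    conv_lhs => rw [← sum_mono z]
    rw [Finset.mul_sum, coord_sum, Finset.sum_eq_single i]
    · rw [e, mono_mul_mono, coord_mono, if_pos (by simp [s, add_comm])]
      simp [add_comm]
    · intro j _ hj
      rw [e, mono_mul_mono, coord_mono, if_neg]
      intro h'
      exact hj (hs (Fin.ext (by simpa [s, add_comm] using h')))
    · simp
  rw [traceForm_eq, traceForm_eq,
    ← Equiv.sum_comp (Equiv.ofBijective s (Finite.injective_iff_bijective.mp hs))]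
  refine Finset.sum_congr rfl fun i _ ↦ ?_
  rw [Equiv.ofBijective_apply, h, h, map_mul (conjL L), map_pow]
  congr 1
  have h1 : conjL L (algebraMap k L (S.γ : k)) ^ (((i : ℕ) + 1) / S.n) *
      algebraMap k L (S.γ : k) ^ (((i : ℕ) + 1) / S.n) = 1 := by
    rw [← mul_pow, mul_comm, S.γ_mul_conj, one_pow]
  linear_combination (S.lam * conjL L (x.coord i) * y.coord i) * h1

theorem φ_add_left (u u' v : S.QuotRing) : S.φ (u + u') v = S.φ u v + S.φ u' v := by
  obtain ⟨x, rfl⟩ := Ideal.Quotient.mk_surjective u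
  obtain ⟨x', rfl⟩ := Ideal.Quotient.mk_surjective u'
  obtain ⟨y, rfl⟩ := Ideal.Quotient.mk_surjective v
  exact (congrArg (Int.cast : ℤ → ZMod S.p) (S.traceFormInt_add_left x x' y)).trans
    (Int.cast_add _ _)

theorem φ_add_right (u v v' : S.QuotRing) : S.φ u (v + v') = S.φ u v + S.φ u v' := by
  obtain ⟨x, rfl⟩ := Ideal.Quotient.mk_surjective u
  obtain ⟨y, rfl⟩ := Ideal.Quotient.mk_surjective v
  obtain ⟨y', rfl⟩ := Ideal.Quotient.mk_surjective v'
  exact (congrArg (Int.cast : ℤ → ZMod S.p) (S.traceFormInt_add_right x y y')).trans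
    (Int.cast_add _ _)

/-- The integer value is obtained by choice, so identities between such values are proved through
the rational trace form. -/
theorem traceFormInt_congr {x y x' y' : S.Λ}
    (h : S.traceForm (x : S.B) y = S.traceForm (x' : S.B) y') :
    S.traceFormInt x y = S.traceFormInt x' y' := by
  rw [traceFormInt_spec, traceFormInt_spec] at h
  exact_mod_cast h

theorem φ_e_mul (u v : S.QuotRing) : S.φ (S.cls S.eΛ * u) (S.cls S.eΛ * v) = S.φ u v := by
  obtain ⟨x, rfl⟩ := Ideal.Quotient.mk_surjective u
  obtain ⟨y, rfl⟩ := Ideal.Quotient.mk_surjective v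
  exact congrArg (Int.cast : ℤ → ZMod S.p) (S.traceFormInt_congr (x := S.eΛ * x) (y := S.eΛ * y)
    (S.traceForm_e_mul x y))

theorem φ_e_pow_mul (i : ℕ) (u v : S.QuotRing) :
    S.φ (S.cls S.eΛ ^ i * u) (S.cls S.eΛ ^ i * v) = S.φ u v := by
  induction i with
  | zero => simp
  | succ i ih => rw [pow_succ', mul_assoc, mul_assoc, φ_e_mul, ih]

theorem φ_mul_inclRes (u v : S.QuotRing) (a : S.ResidueField) :
    S.φ (u * S.inclRes a) v = S.φ u (v * S.inclRes (S.conjBar a)) := by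
  obtain ⟨x, rfl⟩ := Ideal.Quotient.mk_surjective u
  obtain ⟨y, rfl⟩ := Ideal.Quotient.mk_surjective v
  obtain ⟨a, rfl⟩ := S.res_surjective a
  exact congrArg (Int.cast : ℤ → ZMod S.p) (S.traceFormInt_congr (x := x * S.inclΛ a)
    (y' := y * S.inclΛ (S.conjInt a)) (S.traceForm_mul_incl x y a))

/-- Pairing with `e^j w^*` isolates the `j`-th coordinate `b` of a lift and yields `Tr(λ w b)`.
Letting `w` vary puts each coordinate in `𝔓`. -/
theorem φ_nondegenerate {v : S.QuotRing} (hv : ∀ u, S.φ u v = 0) : v = 0 := by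
  obtain ⟨y, rfl⟩ := Ideal.Quotient.mk_surjective v
  refine Ideal.Quotient.eq_zero_iff_mem.mpr (S.mem_PΛ.mpr fun j ↦ ?_)
  obtain ⟨b, hb⟩ := y.2 j
  rw [← hb]
  refine ⟨b, S.mem_𝔓_of_trace fun w ↦ ?_, rfl⟩
  -- The test element carries `w^*` because the form conjugates its first argument, which restores
  -- `w`.
  have h := hv (S.cls (S.eΛ ^ (j : ℕ) * S.inclΛ (S.conjInt w)))
  obtain ⟨m, hm⟩ := (ZMod.intCast_zmod_eq_zero_iff_dvd _ _).mp h
  refine ⟨m, ?_⟩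
  have h2 := S.traceFormInt_spec (S.eΛ ^ (j : ℕ) * S.inclΛ (S.conjInt w)) y
  rw [hm, traceForm_eq] at h2
  have h3 : ((S.eΛ ^ (j : ℕ) * S.inclΛ (S.conjInt w) : S.Λ) : S.B) =
      mono S.σ (S.γ : k) (j : ℕ) (conjL L w) := e_pow_mul_incl _ _
  rw [h3, Finset.sum_eq_single j] at h2
  · rw [← hb, coord_mono, if_pos (Nat.mod_eq_of_lt j.2), Nat.div_eq_of_lt j.2, pow_zero, one_mul,
      conjL_conjL S.real_or_cm] at h2
    simpa using h2
  · intro i _ hi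
    rw [coord_mono, if_neg, map_zero]
    · simp
    · rw [Nat.mod_eq_of_lt j.2]
      exact fun h ↦ hi (Fin.ext h.symm)
  · simp

end CyclicCodeData

/-- A divisor `f` of `X^n - c` with `c c^* = 1` gives the divisor `X^d f^*(1/X)`,
`d ≥ deg f`. -/
theorem Polynomial.reflect_map_dvd_X_pow_sub_C {F : Type*} [Field F] (s : F →+* F) {c : F}
    (hc : c * s c = 1) {n d : ℕ} (hn : 0 < n) {f : Polynomial F} (hd : f.natDegree = d)
    (hf : f ∣ Polynomial.X ^ n - Polynomial.C c) :
    (f.map s).reflect d ∣ Polynomial.X ^ n - Polynomial.C c := by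
  obtain ⟨g, hg⟩ := hf
  have hM : (Polynomial.X ^ n - Polynomial.C c).natDegree = n :=
    Polynomial.natDegree_X_pow_sub_C
  have hM0 : Polynomial.X ^ n - Polynomial.C c ≠ 0 := Polynomial.X_pow_sub_C_ne_zero hn c
  rw [hg] at hM0
  have hdeg : d + g.natDegree = n := by
    rw [← hM, hg, Polynomial.natDegree_mul (left_ne_zero_of_mul hM0)
      (right_ne_zero_of_mul hM0), hd]
  have h1 := congrArg (fun q ↦ (q.map s).reflect n) hg
  simp only [Polynomial.map_mul] at h1
  -- Reversal is multiplicative when the reversal degrees add up, here `d + deg g = n`.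
  rw [← hdeg, Polynomial.reflect_mul _ _ (hd ▸ Polynomial.natDegree_map_le)
    Polynomial.natDegree_map_le, hdeg] at h1
  -- The reversed conjugate of `X^n - c` is `1 - s(c) X^n`, which equals `-s(c) (X^n - c)` since `c
  -- s(c) = 1`.
  have h2 : ((Polynomial.X ^ n - Polynomial.C c).map s).reflect n =
      - Polynomial.C (s c) * (Polynomial.X ^ n - Polynomial.C c) := by
    have h3 : Polynomial.reflect n (Polynomial.X ^ n : Polynomial F) = 1 := by
      simp
    have h4 : Polynomial.C (s c) * Polynomial.C c = 1 := by
      rw [← map_mul, mul_comm, hc, map_one]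
    simp only [Polynomial.map_sub, Polynomial.map_pow, Polynomial.map_X, Polynomial.map_C,
      Polynomial.reflect_sub, h3, Polynomial.reflect_C]
    linear_combination -h4
  rw [h2] at h1
  -- The factor `-c` is the inverse of the unit `-s(c)`.
  refine ⟨-Polynomial.C c * (g.map s).reflect g.natDegree, ?_⟩
  have h4 : Polynomial.C (s c) * Polynomial.C c = 1 := by
    rw [← map_mul, mul_comm, hc, map_one]
  linear_combination (-Polynomial.C c) * h1 - (Polynomial.X ^ n - Polynomial.C c) * h4

/-! ### Skew polynomials as ordinary polynomials when `σ̄` is trivial. -/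

namespace CyclicCodeData

open CyclicAlgebra

variable {k L : Type*} [Field k] [NumberField k] [Field L] [NumberField L] [Algebra k L]
  (S : CyclicCodeData k L)

/-- If `σ̄` is trivial, the skew polynomials are ordinary polynomials. -/
def ofPolynomial (hσ : ∀ x, S.σBar x = x) : Polynomial S.ResidueField →+* S.SkewPoly :=
  Polynomial.eval₂RingHom' SkewPolynomial.CRingHom SkewPolynomial.X fun a ↦ by
    change SkewPolynomial.C a * SkewPolynomial.X = SkewPolynomial.X * SkewPolynomial.C a
    rw [X_mul_C, hσ]

variable {S} in
theorem ofPolynomial_C (hσ : ∀ x, S.σBar x = x) (a : S.ResidueField) :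
    S.ofPolynomial hσ (Polynomial.C a) = SkewPolynomial.C a :=
  Polynomial.eval₂_C _ _

variable {S} in
theorem ofPolynomial_X (hσ : ∀ x, S.σBar x = x) :
    S.ofPolynomial hσ Polynomial.X = SkewPolynomial.X :=
  Polynomial.eval₂_X _ _

variable {S} in
theorem ofPolynomial_monomial (hσ : ∀ x, S.σBar x = x) (n : ℕ) (a : S.ResidueField) :
    S.ofPolynomial hσ (Polynomial.monomial n a) = SkewPolynomial.monomial n a := by
  rw [← Polynomial.C_mul_X_pow_eq_monomial, map_mul, map_pow, ofPolynomial_C, ofPolynomial_X,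
    SkewPolynomial.C_mul_X_pow_eq_monomial]

variable {S} in
theorem coeff_ofPolynomial (hσ : ∀ x, S.σBar x = x) (f : Polynomial S.ResidueField) (m : ℕ) :
    SkewPolynomial.coeff (S.ofPolynomial hσ f) m = f.coeff m := by
  induction f using Polynomial.induction_on' with
  | add p q hp hq => rw [map_add, SkewPolynomial.coeff_add, hp, hq, Polynomial.coeff_add]
  | monomial n a =>
    rw [ofPolynomial_monomial, SkewPolynomial.coeff_monomial, Polynomial.coeff_monomial]

/-- If `σ̄` is trivial, the skew-polynomial ring is the polynomial ring. -/
def polynomialEquiv (hσ : ∀ x, S.σBar x = x) : Polynomial S.ResidueField ≃+* S.SkewPoly :=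
  RingEquiv.ofBijective (S.ofPolynomial hσ) ⟨fun f g h ↦ Polynomial.ext fun m ↦ by
    rw [← coeff_ofPolynomial hσ, h, coeff_ofPolynomial], fun f ↦ by
    induction f using SkewPolynomial.induction with
    | h0 => exact ⟨0, map_zero _⟩
    | ha n r q _ _ hq =>
      obtain ⟨q, rfl⟩ := hq
      exact ⟨Polynomial.monomial n r + q, by rw [map_add, ofPolynomial_monomial]⟩⟩

/-- The polynomial `∑_{i ≤ d} c_i X^i`. -/
def commPoly (d : ℕ) (c : ℕ → S.ResidueField) : Polynomial S.ResidueField :=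
  ∑ i ∈ Finset.range (d + 1), Polynomial.monomial i (c i)

theorem coeff_commPoly (d : ℕ) (c : ℕ → S.ResidueField) (i : ℕ) :
    (S.commPoly d c).coeff i = if i ≤ d then c i else 0 := by
  simp [commPoly, Polynomial.coeff_monomial]

theorem natDegree_commPoly {d : ℕ} {c : ℕ → S.ResidueField} (hc : c d = 1) :
    (S.commPoly d c).natDegree = d := by
  refine Polynomial.natDegree_eq_of_le_of_coeff_ne_zero ?_ (by simp [coeff_commPoly, hc])
  rw [Polynomial.natDegree_le_iff_coeff_eq_zero]
  intro i hi
  rw [coeff_commPoly, if_neg (by omega)]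

theorem monic_commPoly {d : ℕ} {c : ℕ → S.ResidueField} (hc : c d = 1) :
    (S.commPoly d c).Monic := by
  rw [Polynomial.Monic, Polynomial.leadingCoeff, S.natDegree_commPoly hc, coeff_commPoly,
    if_pos le_rfl, hc]

/-- The polynomial `X^n - [γ]_𝔓` as an ordinary polynomial. -/
def commModulus : Polynomial S.ResidueField :=
  Polynomial.X ^ S.n - Polynomial.C (S.res (algebraMap (𝓞 k) (𝓞 L) S.γ))

theorem monic_commModulus : S.commModulus.Monic :=
  Polynomial.monic_X_pow_sub_C _ Module.finrank_pos.ne'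

variable {S} in
theorem polynomialEquiv_commModulus (hσ : ∀ x, S.σBar x = x) :
    S.polynomialEquiv hσ S.commModulus = S.modulus := by
  change S.ofPolynomial hσ _ = _
  rw [commModulus, map_sub, map_pow, ofPolynomial_C, ofPolynomial_X]
  rfl

variable {S} in
theorem polynomialEquiv_commPoly (hσ : ∀ x, S.σBar x = x) (d : ℕ) (c : ℕ → S.ResidueField) :
    S.polynomialEquiv hσ (S.commPoly d c) = S.poly d c := by
  change S.ofPolynomial hσ _ = _
  rw [commPoly, map_sum]
  refine Finset.sum_congr rfl fun i _ ↦ ?_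
  rw [← Polynomial.C_mul_X_pow_eq_monomial, ← Polynomial.X_pow_mul_C, map_mul, map_pow,
    ofPolynomial_C, ofPolynomial_X]

variable {S} in
theorem isMonic_polynomialEquiv (hσ : ∀ x, S.σBar x = x) {f : Polynomial S.ResidueField}
    (hf : f.Monic) : S.IsMonic (S.polynomialEquiv hσ f) := by
  refine ⟨f.natDegree, f.coeff, hf, ?_⟩
  rw [← polynomialEquiv_commPoly hσ]
  congr 1
  exact f.as_sum_range

/-! ### The quotient `Λ/𝒫` as `𝔽_q[X]/(X^n - γ)`. -/

variable [IsGalois k L]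

/-- The ring morphism `𝔽_q[X] → Λ/𝒫`. -/
def evalE (hσ : ∀ x, S.σBar x = x) : Polynomial S.ResidueField →+* S.QuotRing :=
  S.ρ.comp (S.ofPolynomial hσ)

variable {S} (hσ : ∀ x, S.σBar x = x)

theorem evalE_X : S.evalE hσ Polynomial.X = S.cls S.eΛ := by
  rw [evalE, RingHom.comp_apply, ofPolynomial_X, ρ_X]

theorem evalE_C (a : S.ResidueField) : S.evalE hσ (Polynomial.C a) = S.inclRes a := by
  obtain ⟨a, rfl⟩ := S.res_surjective a
  rw [evalE, RingHom.comp_apply, ofPolynomial_C, ρ_C]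
  rfl

theorem evalE_commPoly_res (d : ℕ) (b : ℕ → 𝓞 L) :
    S.evalE hσ (S.commPoly d fun i ↦ S.res (b i)) =
      S.cls (∑ i ∈ Finset.range (d + 1), S.eΛ ^ i * S.inclΛ (b i)) := by
  rw [commPoly, map_sum, map_sum]
  refine Finset.sum_congr rfl fun i _ ↦ ?_
  rw [← Polynomial.C_mul_X_pow_eq_monomial, ← Polynomial.X_pow_mul_C, map_mul, map_pow,
    evalE_X, evalE_C, map_mul, map_pow]
  rfl

theorem evalE_surjective : Function.Surjective (S.evalE hσ) := by
  intro u
  obtain ⟨x, rfl⟩ := Ideal.Quotient.mk_surjective u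
  choose b hb using x.2
  have hx : x = ∑ j : Fin S.n, S.eΛ ^ (j : ℕ) * S.inclΛ (b j) := by
    apply Subtype.ext
    rw [AddSubmonoidClass.coe_finsetSum]
    conv_lhs => rw [← sum_mono (x : S.B)]
    refine Finset.sum_congr rfl fun j _ ↦ ?_
    rw [← hb]
    exact (e_pow_mul_incl _ _).symm
  refine ⟨∑ j : Fin S.n, Polynomial.X ^ (j : ℕ) * Polynomial.C (S.res (b j)), ?_⟩
  change _ = S.cls x
  rw [hx, map_sum, map_sum]
  refine Finset.sum_congr rfl fun j _ ↦ ?_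
  rw [map_mul, map_pow, evalE_X, evalE_C, map_mul, map_pow]
  rfl

theorem eΛ_pow_finrank : S.eΛ ^ S.n = S.inclΛ (algebraMap (𝓞 k) (𝓞 L) S.γ) :=
  Subtype.ext e_pow_finrank

theorem evalE_commModulus : S.evalE hσ S.commModulus = 0 := by
  rw [commModulus, map_sub, map_pow, evalE_X, evalE_C, ← map_pow, eΛ_pow_finrank, sub_eq_zero]
  rfl

/-- Modulo `X^n - γ` one may assume degree less than `n`. Lifts of the coefficients are then the
`e`-coordinates of a lift of the image, and membership in `𝒫` is tested coordinatewise, so a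
vanishing image forces every coefficient to vanish. -/
theorem evalE_eq_zero_iff (f : Polynomial S.ResidueField) :
    S.evalE hσ f = 0 ↔ S.commModulus ∣ f := by
  constructor
  · intro hf
    rw [← Polynomial.modByMonic_eq_zero_iff_dvd S.monic_commModulus]
    have hn : 0 < S.n := Module.finrank_pos
    have hdeg : S.commModulus.natDegree = S.n := Polynomial.natDegree_X_pow_sub_C
    set r := f %ₘ S.commModulus with hr
    have hr0 : S.evalE hσ r = 0 := by
      rw [← Polynomial.modByMonic_add_div f S.commModulus, map_add, map_mul, evalE_commModulus,
        zero_mul, add_zero] at hf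
      exact hf
    have hlt : ∀ i, S.n ≤ i → r.coeff i = 0 := fun i hi ↦ by
      apply Polynomial.coeff_eq_zero_of_degree_lt
      refine lt_of_lt_of_le (Polynomial.degree_modByMonic_lt f S.monic_commModulus) ?_
      rw [Polynomial.degree_eq_natDegree S.monic_commModulus.ne_zero, hdeg]
      exact_mod_cast hi
    choose b hb using fun i ↦ S.res_surjective (r.coeff i)
    -- The sum in `commPoly` includes its upper index, hence `n - 1`.
    have hrb : r = S.commPoly (S.n - 1) fun i ↦ S.res (b i) := by
      ext i
      rw [coeff_commPoly]
      split_ifs with hi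
      · exact (hb i).symm
      · exact hlt i (by omega)
    rw [hrb, evalE_commPoly_res, Nat.sub_add_cancel hn] at hr0
    have hmem := S.mem_PΛ.mp (Ideal.Quotient.eq_zero_iff_mem.mp hr0)
    ext i
    rw [Polynomial.coeff_zero]
    by_cases hi : S.n ≤ i
    · exact hlt i hi
    rw [← hb i]
    obtain ⟨c, hc, hcb⟩ := hmem ⟨i, not_le.mp hi⟩
    have h2 : ((∑ i ∈ Finset.range S.n, S.eΛ ^ i * S.inclΛ (b i) : S.Λ) : S.B) =
        ∑ i ∈ Finset.range S.n, mono S.σ (S.γ : k) i (b i : L) := by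
      rw [AddSubmonoidClass.coe_finsetSum]
      exact Finset.sum_congr rfl fun i _ ↦ e_pow_mul_incl _ _
    rw [h2, coord_sum, Finset.sum_eq_single i] at hcb
    · rw [coord_mono, if_pos (Nat.mod_eq_of_lt (not_le.mp hi)),
        Nat.div_eq_of_lt (not_le.mp hi), pow_zero, one_mul] at hcb
      have : c = b i := RingOfIntegers.ext hcb
      exact Ideal.Quotient.eq_zero_iff_mem.mpr (this ▸ hc)
    · intro j hj hji
      rw [coord_mono, if_neg]
      rw [Nat.mod_eq_of_lt (Finset.mem_range.mp hj)]
      exact hji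
    · intro h
      exact absurd (Finset.mem_range.mpr (not_le.mp hi)) h
  · rintro ⟨g, rfl⟩
    rw [map_mul, evalE_commModulus, zero_mul]

include hσ in
theorem quotRing_mul_comm (u v : S.QuotRing) : u * v = v * u := by
  obtain ⟨f, rfl⟩ := evalE_surjective hσ u
  obtain ⟨g, rfl⟩ := evalE_surjective hσ v
  rw [← map_mul, mul_comm, map_mul]

theorem leftIdeal_polynomialEquiv (f : Polynomial S.ResidueField) :
    S.leftIdeal (S.polynomialEquiv hσ f) = Ideal.span {S.evalE hσ f} := rfl

/-- As `g` divides `X^n - γ`, the kernel of evaluation lies in `(g)`, so membership in the generated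
ideal pulls back exactly to divisibility by `g`. -/
theorem evalE_mem_span_iff {f g : Polynomial S.ResidueField} (hg : g ∣ S.commModulus) :
    S.evalE hσ f ∈ (Ideal.span {S.evalE hσ g} : Ideal S.QuotRing) ↔ g ∣ f := by
  rw [Ideal.mem_span_singleton']
  constructor
  · rintro ⟨u, hu⟩
    obtain ⟨q, rfl⟩ := evalE_surjective hσ u
    rw [← map_mul, ← sub_eq_zero, ← map_sub, evalE_eq_zero_iff] at hu
    exact (dvd_sub_right (dvd_mul_left g q)).mp (hg.trans hu)
  · rintro ⟨q, rfl⟩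
    exact ⟨S.evalE hσ q, by rw [← map_mul, mul_comm]⟩

/-! ### The orthogonal of an ideal as an annihilator. -/

theorem φ_sum_left {ι : Type*} (s : Finset ι) (u : ι → S.QuotRing) (v : S.QuotRing) :
    S.φ (∑ i ∈ s, u i) v = ∑ i ∈ s, S.φ (u i) v :=
  map_sum (AddMonoidHom.mk' (fun u ↦ S.φ u v) fun u u' ↦ S.φ_add_left u u' v) u s

theorem φ_sum_right {ι : Type*} (s : Finset ι) (u : S.QuotRing) (v : ι → S.QuotRing) :
    S.φ u (∑ i ∈ s, v i) = ∑ i ∈ s, S.φ u (v i) :=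
  map_sum (AddMonoidHom.mk' (fun v ↦ S.φ u v) fun v v' ↦ S.φ_add_right u v v') v s

/-- Multiplication by `∑ a_i X^i` is adjoint to multiplication by `X^(-d) ∑ a_(d-i)^* X^i`. -/
theorem φ_evalE_mul (d : ℕ) (c : ℕ → S.ResidueField) (u v : S.QuotRing) :
    S.φ (S.evalE hσ (S.commPoly d c) * u) (S.cls S.eΛ ^ d * v) =
      S.φ u (S.evalE hσ (S.commPoly d fun i ↦ S.conjBar (c (d - i))) * v) := by
  have h : ∀ c : ℕ → S.ResidueField, S.evalE hσ (S.commPoly d c) =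
      ∑ i ∈ Finset.range (d + 1), S.cls S.eΛ ^ i * S.inclRes (c i) := fun c ↦ by
    rw [commPoly, map_sum]
    refine Finset.sum_congr rfl fun i _ ↦ ?_
    rw [← Polynomial.C_mul_X_pow_eq_monomial, ← Polynomial.X_pow_mul_C, map_mul, map_pow,
      evalE_X, evalE_C]
  rw [h, h, Finset.sum_mul, Finset.sum_mul, φ_sum_left, φ_sum_right,
    ← Finset.sum_range_reflect (fun i ↦ S.φ u _)]
  refine Finset.sum_congr rfl fun i hi ↦ ?_
  have hi' : i ≤ d := Nat.lt_succ_iff.mp (Finset.mem_range.mp hi)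
  rw [Nat.add_sub_cancel, Nat.sub_sub_self hi']
  -- Write `e^d = e^i e^(d-i)`. The isometry cancels `e^i`, and the coefficient `c_i` crosses over
  -- as its conjugate, giving the term of degree `d - i` on the right.
  conv_lhs => rw [← Nat.add_sub_cancel' hi', pow_add]
  rw [mul_assoc, mul_assoc, φ_e_pow_mul, quotRing_mul_comm hσ _ u, φ_mul_inclRes,
    mul_assoc, mul_assoc, quotRing_mul_comm hσ v]

/-- The power `e^n` is the class of `γ`, whose inverse is the class of `γ^*`. -/
theorem isUnit_cls_eΛ : IsUnit (S.cls S.eΛ) := by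
  have hn : 0 < S.n := Module.finrank_pos
  have hγ : IsUnit (S.inclRes (S.res (algebraMap (𝓞 k) (𝓞 L) S.γ))) :=
    (IsUnit.of_mul_eq_one _ S.res_γ_mul_conjBar).map S.inclRes
  have h : S.cls S.eΛ ^ S.n = S.inclRes (S.res (algebraMap (𝓞 k) (𝓞 L) S.γ)) := by
    rw [← map_pow, eΛ_pow_finrank]
    rfl
  rw [← h] at hγ
  exact (isUnit_pow_iff hn.ne').mp hγ

include hσ in
-- By nondegeneracy, `v` is orthogonal to all multiples of `g(e)` exactly when the adjoint of `g(e)`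
-- kills `v`. The unit `e^(-d)` in that adjoint does not affect vanishing.
theorem mem_perp_iff (d : ℕ) (c : ℕ → S.ResidueField) (v : S.QuotRing) :
    v ∈ S.perp (S.leftIdeal (S.poly d c)) ↔
      S.evalE hσ (S.commPoly d fun i ↦ S.conjBar (c (d - i))) * v = 0 := by
  obtain ⟨w, hw⟩ := isUnit_cls_eΛ (S := S).pow d
  -- Factoring out `e^d` puts `v` in the form required by `φ_evalE_mul`.
  have hv : v = S.cls S.eΛ ^ d * ((w⁻¹ : S.QuotRingˣ) * v) := by
    rw [← hw, Units.mul_inv_cancel_left]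
  set v' := (w⁻¹ : S.QuotRingˣ) * v
  rw [hv, ← polynomialEquiv_commPoly hσ, leftIdeal_polynomialEquiv]
  have h1 : S.evalE hσ (S.commPoly d fun i ↦ S.conjBar (c (d - i))) * (S.cls S.eΛ ^ d * v') = 0 ↔
      S.evalE hσ (S.commPoly d fun i ↦ S.conjBar (c (d - i))) * v' = 0 := by
    rw [← hw, ← mul_assoc, quotRing_mul_comm hσ _ (w : S.QuotRing), mul_assoc,
      Units.mul_right_eq_zero]
  rw [h1]
  constructor
  · intro h
    refine S.φ_nondegenerate fun u ↦ ?_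
    rw [← φ_evalE_mul]
    refine h _ ?_
    rw [quotRing_mul_comm hσ]
    exact Ideal.mem_span_singleton'.mpr ⟨u, rfl⟩
  · intro h u hu
    obtain ⟨u, rfl⟩ := Ideal.mem_span_singleton'.mp hu
    rw [quotRing_mul_comm hσ, φ_evalE_mul, h]
    -- Additivity at `0 + 0` gives `φ u 0 = 0`.
    have := S.φ_add_right u 0 0
    simpa using this

end CyclicCodeData

/-! ### Conjugate reciprocals of divisors of `X^n - γ`. -/

namespace CyclicCodeData

variable {k L : Type*} [Field k] [NumberField k] [Field L] [NumberField L] [Algebra k L]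
  (S : CyclicCodeData k L)

/-- The constant term of a divisor divides `-γ`, which is a unit modulo `𝔓`. -/
theorem coeff_zero_ne_zero_of_dvd {g : Polynomial S.ResidueField} (hg : g ∣ S.commModulus) :
    g.coeff 0 ≠ 0 := by
  obtain ⟨f, hf⟩ := hg
  intro h
  have h1 := congrArg (Polynomial.coeff · 0) hf
  have hn : S.n ≠ 0 := Module.finrank_pos.ne'
  rw [Polynomial.mul_coeff_zero, h, zero_mul, commModulus, Polynomial.coeff_sub,
    Polynomial.coeff_C_zero, Polynomial.coeff_X_pow, if_neg hn.symm, zero_sub, neg_eq_zero] at h1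
  have h2 := S.res_γ_mul_conjBar
  rw [h1, zero_mul] at h2
  exact zero_ne_one h2

theorem commPoly_conjBar_eq_reflect {d : ℕ} {c : ℕ → S.ResidueField} :
    S.commPoly d (fun i ↦ S.conjBar (c (d - i))) =
      ((S.commPoly d c).map S.conjBar).reflect d := by
  ext i
  rw [Polynomial.coeff_reflect, Polynomial.coeff_map, coeff_commPoly, coeff_commPoly]
  split_ifs with h1 h2 h2
  · rw [Polynomial.revAt_le h1]
  · rw [Polynomial.revAt_le h1] at h2
    omega
  · rw [Polynomial.revAt_eq_self_of_lt (not_le.mp h1)] at h2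
    exact absurd h2 h1
  · rw [map_zero]

theorem commPoly_mul_C (d : ℕ) (c : ℕ → S.ResidueField) (b : S.ResidueField) :
    S.commPoly d (fun i ↦ c i * b) = S.commPoly d c * Polynomial.C b := by
  ext i
  rw [Polynomial.coeff_mul_C, coeff_commPoly, coeff_commPoly, ite_mul, zero_mul]

end CyclicCodeData

end

theorem mainTheorem4 {k L : Type*} [Field k] [NumberField k] [Field L] [NumberField L]
    [Algebra k L] [IsGalois ℚ L] [IsGalois k L] (S : CyclicCodeData k L)
    (hram : S.𝔭.map (algebraMap (𝓞 k) (𝓞 L)) = S.𝔓 ^ Module.finrank k L)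
    (d : ℕ) (a : ℕ → 𝓞 L) (hmonic : S.res (a d) = 1)
    (hdvd : S.poly d (fun i ↦ S.res (a i)) ∣ S.modulus) :
    S.res (S.conjInt (a 0)) ≠ 0 ∧ S.IsMonic (S.polyτ d a) ∧
    (∃ h : S.SkewPoly, S.IsMonic h ∧ h * S.polyτ d a = S.modulus ∧
      S.polyτ d a * h = S.modulus ∧
      S.perp (S.leftIdeal (S.poly d fun i ↦ S.res (a i))) =
        (S.leftIdeal h : Set S.QuotRing)) ∧
    ((S.leftIdeal (S.poly d fun i ↦ S.res (a i)) : Set S.QuotRing) ⊆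
        S.perp (S.leftIdeal (S.poly d fun i ↦ S.res (a i))) ↔
      S.modulus ∣ S.poly d (fun i ↦ S.res (a i)) * S.polyτ d a) ∧
    ((S.leftIdeal (S.poly d fun i ↦ S.res (a i)) : Set S.QuotRing) =
        S.perp (S.leftIdeal (S.poly d fun i ↦ S.res (a i))) ↔
      S.poly d (fun i ↦ S.res (a i)) * S.polyτ d a = S.modulus) := by
  have hσ := S.σBar_eq_id hram
  set c : ℕ → S.ResidueField := fun i ↦ S.res (a i) with hc
  set g := S.commPoly d c with hg
  have hEg : S.poly d c = S.polynomialEquiv hσ g := (S.polynomialEquiv_commPoly hσ d c).symm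
  have hgM : g ∣ S.commModulus := by
    rwa [hEg, ← S.polynomialEquiv_commModulus hσ, map_dvd_iff] at hdvd
  have hgdeg : g.natDegree = d := S.natDegree_commPoly hmonic
  have hgmonic : g.Monic := S.monic_commPoly hmonic
  have ha0 : S.conjBar (c 0) ≠ 0 := by
    have h := S.coeff_zero_ne_zero_of_dvd hgM
    rw [hg, S.coeff_commPoly, if_pos (Nat.zero_le d)] at h
    exact (map_ne_zero S.conjBar).mpr h
  set N := S.commPoly d fun i ↦ S.conjBar (c (d - i)) with hN
  -- The coefficient of `X^d` in `N` is `a_0^*`; dividing by it makes the polynomial monic.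
  set gτ := N * Polynomial.C (S.conjBar (c 0))⁻¹ with hgτ
  have hgτ' : gτ = S.commPoly d fun i ↦ S.conjBar (c (d - i)) * (S.conjBar (c 0))⁻¹ :=
    (S.commPoly_mul_C d _ _).symm
  have hEgτ : S.polyτ d a = S.polynomialEquiv hσ gτ := by
    rw [hgτ', S.polynomialEquiv_commPoly]
    rfl
  have hgτmonic : gτ.Monic := by
    rw [hgτ']
    exact S.monic_commPoly (by rw [Nat.sub_self, mul_inv_cancel₀ ha0])
  have hunit : IsUnit (Polynomial.C (S.conjBar (c 0))⁻¹) :=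
    Polynomial.isUnit_C.mpr (inv_ne_zero ha0).isUnit
  have hgτM : gτ ∣ S.commModulus := by
    rw [hgτ, hunit.mul_right_dvd, hN, S.commPoly_conjBar_eq_reflect]
    exact Polynomial.reflect_map_dvd_X_pow_sub_C _ S.res_γ_mul_conjBar Module.finrank_pos
      hgdeg hgM
  obtain ⟨h, hh⟩ := hgτM
  have hhM : h ∣ S.commModulus := ⟨gτ, by rw [hh, mul_comm]⟩
  have hhmonic : h.Monic := hgτmonic.of_mul_monic_left (hh ▸ S.monic_commModulus)
  -- Up to a unit `N` is `g_τ`, so `N(e) f(e) = 0` means `g_τ h ∣ g_τ f`, and `g_τ` cancels.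
  have hmem (f : Polynomial S.ResidueField) :
      S.evalE hσ f ∈ S.perp (S.leftIdeal (S.poly d c)) ↔ h ∣ f := by
    rw [S.mem_perp_iff hσ, ← map_mul, S.evalE_eq_zero_iff, ← hN, ← hunit.dvd_mul_right,
      mul_right_comm, ← hgτ, hh, mul_dvd_mul_iff_left hgτmonic.ne_zero]
  have hperp : S.perp (S.leftIdeal (S.poly d c)) =
      (S.leftIdeal (S.polynomialEquiv hσ h) : Set S.QuotRing) := by
    ext v
    obtain ⟨f, rfl⟩ := S.evalE_surjective hσ v
    rw [hmem, S.leftIdeal_polynomialEquiv, SetLike.mem_coe, S.evalE_mem_span_iff hσ hhM]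
  refine ⟨ha0, hEgτ ▸ S.isMonic_polynomialEquiv hσ hgτmonic, ⟨S.polynomialEquiv hσ h,
    S.isMonic_polynomialEquiv hσ hhmonic, ?_, ?_, hperp⟩, ?_, ?_⟩
  · rw [hEgτ, ← map_mul, mul_comm, ← hh, S.polynomialEquiv_commModulus]
  · rw [hEgτ, ← map_mul, ← hh, S.polynomialEquiv_commModulus]
  -- The inclusion amounts to `h ∣ g`; multiplication by `g_τ` turns this into `X^n - γ ∣ g g_τ`.
  · rw [hperp, hEgτ, hEg, ← map_mul, ← S.polynomialEquiv_commModulus hσ, map_dvd_iff,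
      SetLike.coe_subset_coe, S.leftIdeal_polynomialEquiv, S.leftIdeal_polynomialEquiv,
      Ideal.span_singleton_le_iff_mem, S.evalE_mem_span_iff hσ hhM, hh, mul_comm g,
      mul_dvd_mul_iff_left hgτmonic.ne_zero]
  · rw [hperp, hEgτ, hEg, ← map_mul, ← S.polynomialEquiv_commModulus hσ,
      (S.polynomialEquiv hσ).injective.eq_iff, SetLike.coe_set_eq, S.leftIdeal_polynomialEquiv,
      S.leftIdeal_polynomialEquiv, hh, mul_comm g, mul_right_inj' hgτmonic.ne_zero]
    constructor
    · intro hgh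
      -- Both generators divide `X^n - γ`, so equal ideals give mutual divisibility, and monic
      -- associates coincide.
      refine Polynomial.eq_of_monic_of_associated hgmonic hhmonic (associated_of_dvd_dvd ?_ ?_)
      · rw [← S.evalE_mem_span_iff hσ hgM, hgh]
        exact Ideal.mem_span_singleton_self _
      · rw [← S.evalE_mem_span_iff hσ hhM, ← hgh]
        exact Ideal.mem_span_singleton_self _
    · rintro rfl
      rfl
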